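/- For $n\ge 1$ let $NC(n)$ be the lattice of non-crossing partitions of $\{1,\dots,n\}$ ordered by $\alpha\le\beta$ if every block of $\alpha$ is contained in a block of $\beta$, with join $\vee$. Identify $\alpha\in NC(n)$ with the permutation in $S_n$ whose cycles are the blocks of $\alpha$ written in increasing order, and let $\|\sigma\|$ denote the minimal number of transpositions whose product is $\sigma\in S_n$. For integers $r,a,b\ge 0$ put $$M_{n,r,a,b}=\{(\alpha,\beta)\in NC(n)^2:\ \|\alpha^{-1}\beta\|=r,\ \|\alpha^{-1}(\alpha\vee\beta)\|=a,\ \|\beta^{-1}(\alpha\vee\beta)\|=b\},$$ $$g_{r,a,b}(X)=\sum_{n\ge1}|M_{n,r,a,b}|\,X^n,\qquad \tilde g_{r,a,b}(W)=g_{r,a,b}\!\left(\frac{W}{(1+W)^2}\right),$$ as formal power series. Call $(r,a,b)$ compatible if (1) $a,b\le\max(2r-2,1)$; (2) $|a-b|\le r\le a+b$; (3) $a-b$ and $a+b$ have the same parity as $r$; (4) if $r=|a-b|$, then $\min(a,b)=0$ and $\max(a,b)=r$. Then $\tilde g_{0,0,0}(W)=W$, and $\tilde g_{0,a,b}(W)=0$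 for all $(a,b)\neq(0,0)$. Moreover, for every $r\ge1$ and all $a,b$ such that $(r,a,b)$ is compatible, there is a polynomial $P_{r,a,b}$ with rational coefficients and of degree at most $3r-3$ such that $$\tilde g_{r,a,b}(W)=\frac{W^{r+1}(1+W)\,P_{r,a,b}(W)}{(1-W)^{2r-1}}.$$ -/

import Mathlib

open scoped PowerSeries Polynomial

/-- A non-crossing partition of an ordered set of `n` points: an equivalence relation (its classes
are the blocks) such that no two distinct blocks contain `a, b` and `c, d` respectively with
`a < c < b < d`. -/
@[ext]
structure NCPartition (n : ℕ) where
  /-- being in the same block -/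
  rel : Setoid (Fin n)
  noncrossing : ∀ a c b d : Fin n, a < c → c < b → b < d → rel a b → rel c d → rel a c

namespace NCPartition

variable {n : ℕ}

/-- Reversed refinement: `α ≤ β` if every block of `α` is contained in a block of `β`. -/
instance : PartialOrder (NCPartition n) :=
  PartialOrder.lift NCPartition.rel fun _ _ h => NCPartition.ext h

/-- The join of `α` and `β` inside `NC(n)`: the common refinement of all non-crossing partitions
lying above both of them. (It may be coarser than the join of `α` and `β` as set partitions.) -/
def join (α β : NCPartition n) : NCPartition n where
  rel := sInf {s | ∃ γ : NCPartition n, α ≤ γ ∧ β ≤ γ ∧ γ.rel = s}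
  noncrossing := by
    intro a c b d hac hcb hbd hab hcd
    intro s hs
    obtain ⟨γ, hα, hβ, h⟩ := hs
    subst h
    exact γ.noncrossing a c b d hac hcb hbd
      (hab _ ⟨γ, hα, hβ, rfl⟩) (hcd _ ⟨γ, hα, hβ, rfl⟩)

/-- `α ⊔ β` is the least upper bound of `α` and `β` in `NC(n)`. -/
instance : SemilatticeSup (NCPartition n) where
  sup := join
  le_sup_left α β := by
    change α.rel ≤ sInf _
    refine le_sInf ?_
    rintro s ⟨γ, hα, hβ, rfl⟩
    exact hα
  le_sup_right α β := by
    change β.rel ≤ sInf _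
    refine le_sInf ?_
    rintro s ⟨γ, hα, hβ, rfl⟩
    exact hβ
  sup_le α β γ hα hβ := by
    change sInf _ ≤ γ.rel
    exact sInf_le ⟨γ, hα, hβ, rfl⟩

instance : Finite (NCPartition n) :=
  Finite.of_injective (fun (α : NCPartition n) (i j : Fin n) => α.rel i j) fun α β h =>
    NCPartition.ext (Setoid.ext fun i j => by
      have := congrFun (congrFun h i) j
      exact iff_of_eq this)

open Classical in
/-- The block containing `i`. -/
noncomputable def block (α : NCPartition n) (i : Fin n) : Finset (Fin n) :=
  Finset.univ.filter fun j => α.rel i j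

open Classical in
/-- The successor of `i` in its block, the block being read cyclically in increasing order: the
smallest larger element of the block if there is one, and the minimum of the block otherwise. -/
noncomputable def next (α : NCPartition n) (i : Fin n) : Fin n :=
  if h : ((α.block i).filter fun j => i < j).Nonempty then
    ((α.block i).filter fun j => i < j).min' h
  else (α.block i).min' ⟨i, by simp [block]⟩

theorem next_injective (α : NCPartition n) : Function.Injective α.next := by
  have mem : ∀ i, α.rel i (α.next i) := by
    intro i
    unfold next
    split_ifs with h
    · have := Finset.min'_mem _ h
      simp only [block, Finset.mem_filter, Finset.mem_univ, true_and] at this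
      exact this.1
    · have := Finset.min'_mem (α.block i) ⟨i, by simp [block]⟩
      simpa only [block, Finset.mem_filter, Finset.mem_univ, true_and] using this
  have key : ∀ i j, i < j → α.next i = α.next j → False := by
    intro i j hij h
    have hrel : α.rel i j := α.rel.trans (mem i) (h ▸ α.rel.symm (mem j))
    have hj : j ∈ (α.block i).filter fun k => i < k := by simp [block, hrel, hij]
    have hi : i < α.next i ∧ α.next i ≤ j := by
      have hne : ((α.block i).filter fun k => i < k).Nonempty := ⟨j, hj⟩
      unfold next
      rw [dif_pos hne]
      exact ⟨(Finset.mem_filter.1 (Finset.min'_mem _ hne)).2, Finset.min'_le _ _ hj⟩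
    have hnj : j < α.next j ∨ α.next j ≤ i := by
      unfold next
      split_ifs with hne
      · exact Or.inl (Finset.mem_filter.1 (Finset.min'_mem _ hne)).2
      · exact Or.inr (Finset.min'_le _ _ (by simp [block, α.rel.symm hrel]))
    rcases hnj with h1 | h1
    · exact absurd (h ▸ hi.2) (not_le.2 h1)
    · exact absurd (h ▸ hi.1) (not_lt.2 h1)
  intro i j h
  rcases lt_trichotomy i j with hij | hij | hij
  · exact (key i j hij h).elim
  · exact hij
  · exact (key j i hij h.symm).elim

/-- The non-crossing (geodesic) permutation identified with a non-crossing partition: every block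
becomes a cycle whose elements are ordered increasingly. -/
noncomputable def toPerm (α : NCPartition n) : Equiv.Perm (Fin n) :=
  Equiv.ofBijective α.next (Finite.injective_iff_bijective.1 α.next_injective)

end NCPartition

/-- The length of a permutation: the minimal number of transpositions whose product it is. -/
noncomputable def permLength {n : ℕ} (σ : Equiv.Perm (Fin n)) : ℕ :=
  sInf {m | ∃ l : List (Equiv.Perm (Fin n)), (∀ τ ∈ l, τ.IsSwap) ∧ l.prod = σ ∧ l.length = m}

/-- The distance `‖α⁻¹ β‖` of two non-crossing partitions, through their permutations. -/
noncomputable def ncDist {n : ℕ} (α β : NCPartition n) : ℕ :=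
  permLength (α.toPerm⁻¹ * β.toPerm)

/-- The set `M_{n,r,a,b}` of all pairs of non-crossing partitions (meandric systems on `2n` points)
with `‖α⁻¹ β‖ = r`, `‖α⁻¹ (α ∨ β)‖ = a` and `‖β⁻¹ (α ∨ β)‖ = b`. -/
def meandricPairs (n r a b : ℕ) : Set (NCPartition n × NCPartition n) :=
  {p | ncDist p.1 p.2 = r ∧ ncDist p.1 (p.1 ⊔ p.2) = a ∧ ncDist p.2 (p.1 ⊔ p.2) = b}

/-- The coefficient `g_{r,a,b}(X) = ∑_{n ≥ 1} |M_{n,r,a,b}| Xⁿ` of `Y^r A^a B^b` in the generating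
series `M(X, Y, A, B)`. -/
noncomputable def gCoeff (r a b : ℕ) : ℚ⟦X⟧ :=
  PowerSeries.mk fun n => if n = 0 then 0 else ((meandricPairs n r a b).ncard : ℚ)

/-- The formal power series `W / (1 + W)²`. -/
noncomputable def changeVar : ℚ⟦X⟧ :=
  PowerSeries.X * ((1 + PowerSeries.X) ^ 2)⁻¹

theorem changeVar_hasSubst : PowerSeries.HasSubst changeVar :=
  PowerSeries.HasSubst.of_constantCoeff_zero' (by simp [changeVar])

/-- `g̃_{r,a,b}(W) = g_{r,a,b}(W / (1 + W)²)`. -/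
noncomputable def gTilde (r a b : ℕ) : ℚ⟦X⟧ :=
  PowerSeries.subst changeVar (gCoeff r a b)

/-- Compatible triples of non-negative integers. -/
def Compatible (r a b : ℕ) : Prop :=
  ((a : ℤ) ≤ max (2 * (r : ℤ) - 2) 1 ∧ (b : ℤ) ≤ max (2 * (r : ℤ) - 2) 1) ∧
  (|(a : ℤ) - b| ≤ r ∧ r ≤ a + b) ∧
  ((a : ℤ) - b ≡ r [ZMOD 2] ∧ (a : ℤ) + b ≡ r [ZMOD 2]) ∧
  ((r : ℤ) = |(a : ℤ) - b| → min a b = 0 ∧ max a b = r)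

/-!
Cut a pair `(α, β)` along the blocks of `α ⊔ β`. Every block carries a pair whose join has a single
block, the three distances add up over the blocks, and the points strictly between two consecutive
points of a block, or after its last point, carry an arbitrary pair. For the generating series `M`
of all pairs and `c` of the pairs with one-block join, with coefficients in `ℚ[Y, A, B]`, this is
the functional equation `M = c(X * M)`. It is obtained by cutting off one interval at a time
(`NCPartition.tailSum_eq_sum_antidiagonal`), and Lagrange inversion turns it into
`(n + 1) * M_n = [tⁿ] c(t) ^ (n + 1)`.

A pair with one-block join in which `i` is a fixed point of `α⁻¹ β` has `i` and its cyclic successor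
in the same block of `α` and of `β`, since the points enclosed by a longer common arc would be cut
off from the rest. So `i` can be contracted without changing any of the three distances
(`NCPartition.supportSum_succAbove`), and `c(t) = (1 - t)⁻¹ * (1 + ρ(t / (1 - t)))`, where `ρ`
counts the pairs on at least one point for which the join has one block and `α⁻¹ β` moves every
point. A permutation of length `r` that moves all of `k ≥ 1` points satisfies `r + 1 ≤ k ≤ 2 * r`;
so only finitely many such pairs contribute to a given `r`. The binomial theorem then gives
(`NCPartition.ncard_meandricPairs_eq_sum`) the count, for `r ≥ 1`, as a combination of the numbers
`(n choose j) * (2 * n choose n + k)` with `j < r < k ≤ 2 * r`.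

Under `X = W / (1 + W) ^ 2` the series `∑ (2 * n choose n + k) * X ^ n` becomes
`W ^ k * (1 + W) / (1 - W)`, and `X * d/dX` becomes `W * (1 + W) / (1 - W) * d/dW`. Each factor
`n - i` in `n choose j` therefore costs two powers of `1 - W` in the denominator and two degrees in
the numerator, which yields the stated denominator and degree bound. For `r = 0` the count is a
Catalan number.

The length of a permutation is computed as the codimension of its space of invariant functions,
which makes additivity over invariant parts immediate.
-/

/-! ### Length of permutations -/

/-- The functions `Fin n → ℚ` that are constant on the orbits of `σ`. -/
def invariantFunctions {n : ℕ} (σ : Equiv.Perm (Fin n)) : Submodule ℚ (Fin n → ℚ) where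
  carrier := {f | ∀ i, f (σ i) = f i}
  add_mem' := by intro f g hf hg i; simp [hf i, hg i]
  zero_mem' := by intro i; rfl
  smul_mem' := by intro c f hf i; simp [hf i]

theorem mem_invariantFunctions {n : ℕ} {σ : Equiv.Perm (Fin n)} {f : Fin n → ℚ} :
    f ∈ invariantFunctions σ ↔ ∀ i, f (σ i) = f i := Iff.rfl

theorem finrank_invariantFunctions_le {n : ℕ} (σ : Equiv.Perm (Fin n)) :
    Module.finrank ℚ (invariantFunctions σ) ≤ n := by
  simpa using Submodule.finrank_le (invariantFunctions σ)

/-- Multiplication by a transposition lowers the dimension of the space of invariant functions by at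
most one. -/
theorem le_length_add_finrank_invariantFunctions {n : ℕ} (l : List (Equiv.Perm (Fin n)))
    (hl : ∀ τ ∈ l, τ.IsSwap) :
    n ≤ l.length + Module.finrank ℚ (invariantFunctions l.prod) := by
  induction l with
  | nil =>
    have : invariantFunctions (1 : Equiv.Perm (Fin n)) = ⊤ := by
      ext f; simp [mem_invariantFunctions]
    rw [List.prod_nil, this]
    simp
  | cons τ l ih =>
    have ih' := ih fun τ h => hl τ (List.mem_cons_of_mem _ h)
    obtain ⟨a, b, -, rfl⟩ := hl τ List.mem_cons_self
    let φ : (Fin n → ℚ) →ₗ[ℚ] ℚ :=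
      LinearMap.proj (R := ℚ) (φ := fun _ : Fin n => ℚ) a - LinearMap.proj b
    have hle : invariantFunctions l.prod ⊓ LinearMap.ker φ ≤
        invariantFunctions (Equiv.swap a b * l.prod) := by
      rintro f ⟨hf, hφ⟩ i
      have hab : f a = f b := by simpa [φ, sub_eq_zero] using hφ
      have hs : ∀ j, f (Equiv.swap a b j) = f j := by
        intro j
        rw [Equiv.swap_apply_def]
        split_ifs with h1 h2
        · rw [h1, hab]
        · rw [h2, hab]
        · rfl
      rw [Equiv.Perm.mul_apply, hs]
      exact hf i
    have h1 := Submodule.finrank_mono hle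
    have h2 := Submodule.finrank_sup_add_finrank_inf_eq (invariantFunctions l.prod)
      (LinearMap.ker φ)
    have h3 := LinearMap.finrank_range_add_finrank_ker φ
    have h4 := Submodule.finrank_le (invariantFunctions l.prod ⊔ LinearMap.ker φ)
    have h5 := Submodule.finrank_le (LinearMap.range φ)
    simp only [Module.finrank_fintype_fun_eq_card, Fintype.card_fin, Module.finrank_self]
      at h3 h4 h5
    rw [List.prod_cons, List.length_cons]
    omega

/-- If `σ` moves `a`, then multiplying it by the transposition of `a` and `σ a` raises the dimension
of the space of invariant functions. -/
theorem exists_swaps_length_add_finrank_invariantFunctions_le {n : ℕ} (σ : Equiv.Perm (Fin n)) :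
    ∃ l : List (Equiv.Perm (Fin n)), (∀ τ ∈ l, τ.IsSwap) ∧ l.prod = σ ∧
      l.length + Module.finrank ℚ (invariantFunctions σ) ≤ n := by
  induction hd : n - Module.finrank ℚ (invariantFunctions σ) using Nat.strong_induction_on
    generalizing σ with
  | _ d ih =>
    by_cases hσ : σ = 1
    · exact ⟨[], by simp, by simp [hσ], by simpa using finrank_invariantFunctions_le σ⟩
    obtain ⟨a, ha⟩ : ∃ a, σ a ≠ a := by
      by_contra! h
      exact hσ (Equiv.ext h)
    have hlt : invariantFunctions σ < invariantFunctions (Equiv.swap a (σ a) * σ) := by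
      refine lt_of_le_of_ne ?_ ?_
      · intro f hf i
        rw [Equiv.Perm.mul_apply, Equiv.swap_apply_def]
        split_ifs with h1 h2
        · rw [hf a, ← h1, hf i]
        · rw [σ.injective h2]
        · exact hf i
      -- the indicator function of `a` is invariant under the product, which fixes `a`
      · intro h
        have hmem : (Pi.single a 1 : Fin n → ℚ) ∈
            invariantFunctions (Equiv.swap a (σ a) * σ) := by
          have hfix : (Equiv.swap a (σ a) * σ) a = a := by simp
          intro i
          by_cases hi : i = a
          · rw [hi, hfix]
          · rw [Pi.single_eq_of_ne hi, Pi.single_eq_of_ne]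
            intro h'
            exact hi ((Equiv.swap a (σ a) * σ).injective (h'.trans hfix.symm))
        rw [← h] at hmem
        have := hmem a
        rw [Pi.single_eq_of_ne ha, Pi.single_eq_same] at this
        exact zero_ne_one this
    have hfr := Submodule.finrank_lt_finrank_of_lt hlt
    have hle := finrank_invariantFunctions_le (Equiv.swap a (σ a) * σ)
    obtain ⟨l, hl, hprod, hlen⟩ := ih _ (by omega) (Equiv.swap a (σ a) * σ) rfl
    refine ⟨Equiv.swap a (σ a) :: l, ?_, ?_, ?_⟩
    · intro τ hτ
      rcases List.mem_cons.1 hτ with rfl | h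
      · exact ⟨a, σ a, Ne.symm ha, rfl⟩
      · exact hl _ h
    · rw [List.prod_cons, hprod, ← mul_assoc, Equiv.swap_mul_self, one_mul]
    · rw [List.length_cons]; omega

theorem exists_swaps_length_eq_permLength {n : ℕ} (σ : Equiv.Perm (Fin n)) :
    ∃ l : List (Equiv.Perm (Fin n)), (∀ τ ∈ l, τ.IsSwap) ∧ l.prod = σ ∧
      l.length = permLength σ := by
  have hne : {m | ∃ l : List (Equiv.Perm (Fin n)), (∀ τ ∈ l, τ.IsSwap) ∧ l.prod = σ ∧
      l.length = m}.Nonempty := by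
    obtain ⟨l, hl, hp, -⟩ := exists_swaps_length_add_finrank_invariantFunctions_le σ
    exact ⟨_, l, hl, hp, rfl⟩
  exact Nat.sInf_mem hne

/-- The length of `σ` is `n` minus its number of orbits, the latter being the dimension of the
space of invariant functions. -/
theorem permLength_add_finrank {n : ℕ} (σ : Equiv.Perm (Fin n)) :
    permLength σ + Module.finrank ℚ (invariantFunctions σ) = n := by
  apply le_antisymm
  · obtain ⟨l, hl, hp, hlen⟩ := exists_swaps_length_add_finrank_invariantFunctions_le σ
    have : permLength σ ≤ l.length := Nat.sInf_le ⟨l, hl, hp, rfl⟩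
    omega
  · obtain ⟨l, hl, hp, hlen⟩ := exists_swaps_length_eq_permLength σ
    have := le_length_add_finrank_invariantFunctions l hl
    rwa [hp, hlen] at this

theorem permLength_one {n : ℕ} : permLength (1 : Equiv.Perm (Fin n)) = 0 :=
  Nat.sInf_eq_zero.2 (Or.inl ⟨[], by simp⟩)

theorem permLength_lt {n : ℕ} (hn : 0 < n) (σ : Equiv.Perm (Fin n)) : permLength σ < n := by
  have h := permLength_add_finrank σ
  have : 0 < Module.finrank ℚ (invariantFunctions σ) := by
    have : Nontrivial (invariantFunctions σ) := by
      refine ⟨⟨⟨fun _ => 1, fun _ => rfl⟩, 0, ?_⟩⟩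
      intro h
      have := congrFun (congrArg Subtype.val h) ⟨0, hn⟩
      exact one_ne_zero this
    exact Module.finrank_pos
  omega

theorem card_le_two_mul_permLength {n : ℕ} (σ : Equiv.Perm (Fin n)) (hσ : ∀ i, σ i ≠ i) :
    n ≤ 2 * permLength σ := by
  obtain ⟨l, hl, hp, hlen⟩ := exists_swaps_length_eq_permLength σ
  have key : ∀ l : List (Equiv.Perm (Fin n)), (∀ τ ∈ l, τ.IsSwap) →
      l.prod.support.card ≤ 2 * l.length := by
    intro l hl
    induction l with
    | nil => simp
    | cons τ l ih =>
      have h1 := Finset.card_le_card (Equiv.Perm.support_mul_le τ l.prod)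
      have h2 := Equiv.Perm.card_support_eq_two.2 (hl τ List.mem_cons_self)
      have h3 := ih fun τ h => hl τ (List.mem_cons_of_mem _ h)
      have h4 := Finset.card_union_le τ.support l.prod.support
      rw [List.prod_cons, List.length_cons]
      simp only [Finset.sup_eq_union] at h1
      omega
  have h := key l hl
  have hs : σ.support = Finset.univ := by ext i; simp [hσ i]
  rw [hp, hs, hlen] at h
  simpa using h

theorem bijective_sumElim_of_complementary {m k n : ℕ} {f : Fin m → Fin n} {h : Fin k → Fin n}
    (hf : f.Injective) (hh : h.Injective) (hdisj : ∀ x y, f x ≠ h y)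
    (hcov : ∀ z, (∃ x, f x = z) ∨ ∃ y, h y = z) : Function.Bijective (Sum.elim f h) := by
  refine ⟨Function.Injective.sumElim hf hh hdisj, fun z => ?_⟩
  rcases hcov z with ⟨x, hx⟩ | ⟨y, hy⟩
  · exact ⟨Sum.inl x, hx⟩
  · exact ⟨Sum.inr y, hy⟩

theorem card_eq_add_of_complementary {m k n : ℕ} {f : Fin m → Fin n} {h : Fin k → Fin n}
    (hf : f.Injective) (hh : h.Injective) (hdisj : ∀ x y, f x ≠ h y)
    (hcov : ∀ z, (∃ x, f x = z) ∨ ∃ y, h y = z) : n = m + k := by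
  have hb := bijective_sumElim_of_complementary hf hh hdisj hcov
  have := Fintype.card_congr (Equiv.ofBijective _ hb)
  simpa using this.symm

/-- The length is additive when the underlying set splits into two invariant parts. -/
theorem permLength_eq_add_of_complementary {m k n : ℕ} {f : Fin m → Fin n} {h : Fin k → Fin n}
    (hf : f.Injective) (hh : h.Injective) (hdisj : ∀ x y, f x ≠ h y)
    (hcov : ∀ z, (∃ x, f x = z) ∨ ∃ y, h y = z)
    {σ : Equiv.Perm (Fin n)} {σ₁ : Equiv.Perm (Fin m)} {σ₂ : Equiv.Perm (Fin k)}
    (h₁ : ∀ x, σ (f x) = f (σ₁ x)) (h₂ : ∀ y, σ (h y) = h (σ₂ y)) :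
    permLength σ = permLength σ₁ + permLength σ₂ := by
  have hb := bijective_sumElim_of_complementary hf hh hdisj hcov
  let e := Equiv.ofBijective _ hb
  have hel : ∀ x, e.symm (f x) = Sum.inl x := fun x => e.symm_apply_eq.2 rfl
  have her : ∀ y, e.symm (h y) = Sum.inr y := fun y => e.symm_apply_eq.2 rfl
  let L : invariantFunctions σ ≃ₗ[ℚ] invariantFunctions σ₁ × invariantFunctions σ₂ :=
    { toFun := fun g => (⟨fun x => g.1 (f x), fun x => (congrArg g.1 (h₁ x)).symm.trans (g.2 _)⟩,
        ⟨fun y => g.1 (h y), fun y => (congrArg g.1 (h₂ y)).symm.trans (g.2 _)⟩)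
      map_add' := fun _ _ => rfl
      map_smul' := fun _ _ => rfl
      invFun := fun g => ⟨fun z => Sum.elim g.1.1 g.2.1 (e.symm z), by
        intro z
        rcases hcov z with ⟨x, rfl⟩ | ⟨y, rfl⟩
        · simpa only [h₁, hel, Sum.elim_inl] using g.1.2 x
        · simpa only [h₂, her, Sum.elim_inr] using g.2.2 y⟩
      left_inv := by
        intro g
        ext z
        rcases hcov z with ⟨x, rfl⟩ | ⟨y, rfl⟩
        · simp [hel]
        · simp [her]
      right_inv := by
        intro g
        ext z
        · simp [hel]
        · simp [her] }
  have hL := L.finrank_eq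
  rw [Module.finrank_prod] at hL
  have hn := card_eq_add_of_complementary hf hh hdisj hcov
  have e1 := permLength_add_finrank σ
  have e2 := permLength_add_finrank σ₁
  have e3 := permLength_add_finrank σ₂
  omega

/-! ### Induced partitions and unions along an interval -/

namespace NCPartition

variable {n m k : ℕ}

theorem rel_of_le {α β : NCPartition n} (h : α ≤ β) {x y : Fin n} (hxy : α.rel x y) :
    β.rel x y := h hxy

theorem le_of_rel {α β : NCPartition n} (h : ∀ x y, α.rel x y → β.rel x y) : α ≤ β :=
  fun {x y} hxy => h x y hxy

theorem ext_rel {α β : NCPartition n} (h : ∀ x y, α.rel x y ↔ β.rel x y) : α = β :=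
  le_antisymm (le_of_rel fun x y => (h x y).1) (le_of_rel fun x y => (h x y).2)

/-- The partition with a single block. -/
instance : OrderTop (NCPartition n) where
  top := ⟨⊤, fun _ _ _ _ _ _ _ _ _ => trivial⟩
  le_top _ := fun {_ _} _ => trivial

theorem top_rel (x y : Fin n) : (⊤ : NCPartition n).rel x y := trivial

theorem eq_top_of_rel {α : NCPartition n} (h : ∀ x y, α.rel x y) : α = ⊤ :=
  top_le_iff.1 (le_of_rel fun x y _ => h x y)

/-- The successor of `i` in its cyclically ordered block: either the next larger element of the
block or, if `i` is the maximum of the block, its minimum. -/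
theorem next_spec (α : NCPartition n) (i : Fin n) :
    α.rel i (α.next i) ∧
      ((i < α.next i ∧ ∀ x, α.rel i x → i < x → α.next i ≤ x) ∨
        (α.next i ≤ i ∧ ∀ x, α.rel i x → α.next i ≤ x ∧ x ≤ i)) := by
  classical
  unfold next
  split_ifs with h
  · have hm := Finset.min'_mem _ h
    simp only [block, Finset.mem_filter, Finset.mem_univ, true_and] at hm
    refine ⟨hm.1, Or.inl ⟨hm.2, fun x hx hix => Finset.min'_le _ _ ?_⟩⟩
    simp [block, hx, hix]
  · have hm := Finset.min'_mem (α.block i) ⟨i, by simp [block]⟩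
    have hm' : α.rel i ((α.block i).min' ⟨i, by simp [block]⟩) := by
      simpa only [block, Finset.mem_filter, Finset.mem_univ, true_and] using hm
    have hle : ∀ x, α.rel i x → (α.block i).min' ⟨i, by simp [block]⟩ ≤ x := fun x hx =>
      Finset.min'_le _ _ (by simp [block, hx])
    refine ⟨hm', Or.inr ⟨hle i (α.rel.refl i), fun x hx => ⟨hle x hx, ?_⟩⟩⟩
    by_contra hlt
    exact h ⟨x, by simp [block, hx, not_le.1 hlt]⟩

theorem next_eq_iff (α : NCPartition n) (i j : Fin n) :
    α.next i = j ↔ α.rel i j ∧ ((i < j ∧ ∀ x, α.rel i x → i < x → j ≤ x) ∨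
        (j ≤ i ∧ ∀ x, α.rel i x → j ≤ x ∧ x ≤ i)) := by
  constructor
  · rintro rfl
    exact α.next_spec i
  · rintro ⟨hij, h⟩
    obtain ⟨hn, h'⟩ := α.next_spec i
    rcases h with ⟨h1, h2⟩ | ⟨h1, h2⟩ <;> rcases h' with ⟨h3, h4⟩ | ⟨h3, h4⟩
    · exact le_antisymm (h4 _ hij h1) (h2 _ hn h3)
    · exact absurd (h4 _ hij).2 (not_le.2 h1)
    · exact absurd (h2 _ hn).2 (not_le.2 h3)
    · exact le_antisymm (h4 _ hij).1 (h2 _ hn).1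

theorem toPerm_apply (α : NCPartition n) (i : Fin n) : α.toPerm i = α.next i := rfl

/-- Iterating `next` from `i` reaches every larger point of the block of `i`, so `next` determines
the partition. -/
theorem le_of_next_eq {α β : NCPartition n} (h : ∀ i, α.next i = β.next i) : α ≤ β := by
  have key : ∀ d : ℕ, ∀ i j : Fin n, i ≤ j → (j : ℕ) - i = d → α.rel i j → β.rel i j := by
    intro d
    induction d using Nat.strong_induction_on with
    | _ d ih =>
      intro i j hij hd hrel
      rcases hij.eq_or_lt with rfl | hlt
      · exact β.rel.refl _
      obtain ⟨h1, ⟨h2, h3⟩ | ⟨h2, h3⟩⟩ := α.next_spec i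
      · have h4 := h3 j hrel hlt
        have h5 : β.rel i (α.next i) := h i ▸ (β.next_spec i).1
        refine β.rel.trans h5 (ih _ ?_ _ _ h4 rfl (α.rel.trans (α.rel.symm h1) hrel))
        omega
      · exact absurd (h3 j hrel).2 (not_le.2 hlt)
  refine le_of_rel fun x y hxy => ?_
  rcases le_total x y with hle | hle
  · exact key _ x y hle rfl hxy
  · exact β.rel.symm (key _ y x hle rfl (α.rel.symm hxy))

theorem toPerm_injective : Function.Injective (toPerm : NCPartition n → Equiv.Perm (Fin n)) := by
  intro α β h
  have h' : ∀ i, α.next i = β.next i := fun i => Equiv.congr_fun h i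
  exact le_antisymm (le_of_next_eq h') (le_of_next_eq fun i => (h' i).symm)

/-- The partition induced on a subset, given by its increasing enumeration `f`. -/
def comap (f : Fin m → Fin n) (hf : StrictMono f) (α : NCPartition n) : NCPartition m where
  rel := α.rel.comap f
  noncrossing _ _ _ _ hac hcb hbd hab hcd :=
    α.noncrossing _ _ _ _ (hf hac) (hf hcb) (hf hbd) hab hcd

theorem comap_mono (f : Fin m → Fin n) (hf : StrictMono f) {α β : NCPartition n} (h : α ≤ β) :
    α.comap f hf ≤ β.comap f hf :=
  le_of_rel fun _ _ hxy => rel_of_le h hxy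

theorem comap_next_of_closed {f : Fin m → Fin n} (hf : StrictMono f) {α : NCPartition n}
    (hα : ∀ x z, α.rel (f x) z → ∃ y, f y = z) (x : Fin m) :
    α.next (f x) = f ((α.comap f hf).next x) := by
  obtain ⟨h1, h2⟩ := (α.comap f hf).next_spec x
  rw [next_eq_iff]
  refine ⟨h1, ?_⟩
  rcases h2 with ⟨h2, h3⟩ | ⟨h2, h3⟩
  · refine Or.inl ⟨hf h2, fun z hz hlt => ?_⟩
    obtain ⟨y, rfl⟩ := hα x z hz
    exact hf.monotone (h3 y hz (hf.lt_iff_lt.1 hlt))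
  · refine Or.inr ⟨hf.monotone h2, fun z hz => ?_⟩
    obtain ⟨y, rfl⟩ := hα x z hz
    exact ⟨hf.monotone (h3 y hz).1, hf.monotone (h3 y hz).2⟩

end NCPartition

/-- `Fin n` is the disjoint union of the ranges of the increasing maps `f` and `h`, the range of `h`
being an interval. -/
structure IntervalCut {m k n : ℕ} (f : Fin m → Fin n) (h : Fin k → Fin n) : Prop where
  left_strictMono : StrictMono f
  right_strictMono : StrictMono h
  disjoint : ∀ x y, f x ≠ h y
  cover : ∀ z, (∃ x, f x = z) ∨ ∃ y, h y = z
  convex : ∀ y₁ y₂ z, h y₁ < z → z < h y₂ → ∃ y, h y = z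

namespace IntervalCut

open NCPartition

variable {m k n : ℕ} {f : Fin m → Fin n} {h : Fin k → Fin n}

/-- The union of a partition of the complement of an interval and a partition of that interval. -/
def glue (hc : IntervalCut f h) (α₁ : NCPartition m) (α₂ : NCPartition k) : NCPartition n where
  rel :=
    { r := fun z w => (∃ x y, f x = z ∧ f y = w ∧ α₁.rel x y) ∨
        ∃ x y, h x = z ∧ h y = w ∧ α₂.rel x y
      iseqv :=
        { refl := fun z => (hc.cover z).imp (fun ⟨x, hx⟩ => ⟨x, x, hx, hx, α₁.rel.refl x⟩)
            fun ⟨x, hx⟩ => ⟨x, x, hx, hx, α₂.rel.refl x⟩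
          symm := fun hzw => hzw.imp (fun ⟨x, y, hx, hy, hr⟩ => ⟨y, x, hy, hx, α₁.rel.symm hr⟩)
            fun ⟨x, y, hx, hy, hr⟩ => ⟨y, x, hy, hx, α₂.rel.symm hr⟩
          trans := by
            rintro _ _ _ (⟨x, y, rfl, rfl, hr⟩ | ⟨x, y, rfl, rfl, hr⟩)
              (⟨x', y', h1, rfl, hr'⟩ | ⟨x', y', h1, rfl, hr'⟩)
            · obtain rfl := hc.left_strictMono.injective h1
              exact Or.inl ⟨x, y', rfl, rfl, α₁.rel.trans hr hr'⟩
            · exact (hc.disjoint _ _ h1.symm).elim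
            · exact (hc.disjoint _ _ h1).elim
            · obtain rfl := hc.right_strictMono.injective h1
              exact Or.inr ⟨x, y', rfl, rfl, α₂.rel.trans hr hr'⟩ } }
  noncrossing := by
    rintro _ _ _ _ hac hcb hbd (⟨a, b, rfl, rfl, hab⟩ | ⟨a, b, rfl, rfl, hab⟩)
      (⟨c, d, rfl, rfl, hcd⟩ | ⟨c, d, rfl, rfl, hcd⟩)
    · refine Or.inl ⟨a, c, rfl, rfl, ?_⟩
      exact α₁.noncrossing a c b d (hc.left_strictMono.lt_iff_lt.1 hac)
        (hc.left_strictMono.lt_iff_lt.1 hcb) (hc.left_strictMono.lt_iff_lt.1 hbd) hab hcd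
    · obtain ⟨y, hy⟩ := hc.convex _ _ _ hcb hbd
      exact (hc.disjoint _ _ hy.symm).elim
    · obtain ⟨y, hy⟩ := hc.convex _ _ _ hac hcb
      exact (hc.disjoint _ _ hy.symm).elim
    · refine Or.inr ⟨a, c, rfl, rfl, ?_⟩
      exact α₂.noncrossing a c b d (hc.right_strictMono.lt_iff_lt.1 hac)
        (hc.right_strictMono.lt_iff_lt.1 hcb) (hc.right_strictMono.lt_iff_lt.1 hbd) hab hcd

variable (hc : IntervalCut f h)

theorem glue_rel_left {α₁ : NCPartition m} {α₂ : NCPartition k} {x y : Fin m} :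
    (hc.glue α₁ α₂).rel (f x) (f y) ↔ α₁.rel x y := by
  constructor
  · rintro (⟨x', y', h1, h2, hr⟩ | ⟨x', y', h1, h2, hr⟩)
    · rwa [hc.left_strictMono.injective h1, hc.left_strictMono.injective h2] at hr
    · exact (hc.disjoint _ _ h1.symm).elim
  · exact fun hr => Or.inl ⟨x, y, rfl, rfl, hr⟩

theorem glue_rel_right {α₁ : NCPartition m} {α₂ : NCPartition k} {x y : Fin k} :
    (hc.glue α₁ α₂).rel (h x) (h y) ↔ α₂.rel x y := by
  constructor
  · rintro (⟨x', y', h1, h2, hr⟩ | ⟨x', y', h1, h2, hr⟩)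
    · exact (hc.disjoint _ _ h1).elim
    · rwa [hc.right_strictMono.injective h1, hc.right_strictMono.injective h2] at hr
  · exact fun hr => Or.inr ⟨x, y, rfl, rfl, hr⟩

theorem not_glue_rel {α₁ : NCPartition m} {α₂ : NCPartition k} (x : Fin m) (y : Fin k) :
    ¬ (hc.glue α₁ α₂).rel (f x) (h y) := by
  rintro (⟨x', y', h1, h2, hr⟩ | ⟨x', y', h1, h2, hr⟩)
  · exact hc.disjoint _ _ h2
  · exact hc.disjoint _ _ h1.symm

theorem comap_glue_left (α₁ : NCPartition m) (α₂ : NCPartition k) :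
    (hc.glue α₁ α₂).comap f hc.left_strictMono = α₁ :=
  ext_rel fun _ _ => hc.glue_rel_left

theorem comap_glue_right (α₁ : NCPartition m) (α₂ : NCPartition k) :
    (hc.glue α₁ α₂).comap h hc.right_strictMono = α₂ :=
  ext_rel fun _ _ => hc.glue_rel_right

theorem glue_comap {α : NCPartition n} (hα : ∀ x y, ¬ α.rel (f x) (h y)) :
    hc.glue (α.comap f hc.left_strictMono) (α.comap h hc.right_strictMono) = α := by
  refine ext_rel fun z w => ?_
  rcases hc.cover z with ⟨x, rfl⟩ | ⟨x, rfl⟩ <;> rcases hc.cover w with ⟨y, rfl⟩ | ⟨y, rfl⟩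
  · exact hc.glue_rel_left
  · exact iff_of_false (hc.not_glue_rel _ _) (hα _ _)
  · exact iff_of_false (fun hr => hc.not_glue_rel _ _ (Setoid.symm' _ hr))
      fun hr => hα _ _ (α.rel.symm hr)
  · exact hc.glue_rel_right

theorem glue_mono {α₁ β₁ : NCPartition m} {α₂ β₂ : NCPartition k} (h₁ : α₁ ≤ β₁) (h₂ : α₂ ≤ β₂) :
    hc.glue α₁ α₂ ≤ hc.glue β₁ β₂ :=
  le_of_rel fun _ _ hzw =>
    hzw.imp (fun ⟨x, y, hx, hy, hr⟩ => ⟨x, y, hx, hy, rel_of_le h₁ hr⟩)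
      fun ⟨x, y, hx, hy, hr⟩ => ⟨x, y, hx, hy, rel_of_le h₂ hr⟩

theorem not_rel_of_le_glue {α : NCPartition n} {β₁ : NCPartition m} {β₂ : NCPartition k}
    (hα : α ≤ hc.glue β₁ β₂) (x : Fin m) (y : Fin k) : ¬ α.rel (f x) (h y) :=
  fun hr => hc.not_glue_rel x y (rel_of_le hα hr)

theorem glue_sup_glue (α₁ β₁ : NCPartition m) (α₂ β₂ : NCPartition k) :
    hc.glue α₁ α₂ ⊔ hc.glue β₁ β₂ = hc.glue (α₁ ⊔ β₁) (α₂ ⊔ β₂) := by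
  have hle : hc.glue α₁ α₂ ⊔ hc.glue β₁ β₂ ≤ hc.glue (α₁ ⊔ β₁) (α₂ ⊔ β₂) :=
    sup_le (hc.glue_mono le_sup_left le_sup_left) (hc.glue_mono le_sup_right le_sup_right)
  refine le_antisymm hle ?_
  rw [← hc.glue_comap (hc.not_rel_of_le_glue hle)]
  refine hc.glue_mono (sup_le ?_ ?_) (sup_le ?_ ?_)
  · exact (hc.comap_glue_left α₁ α₂).ge.trans (comap_mono _ _ le_sup_left)
  · exact (hc.comap_glue_left β₁ β₂).ge.trans (comap_mono _ _ le_sup_right)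
  · exact (hc.comap_glue_right α₁ α₂).ge.trans (comap_mono _ _ le_sup_left)
  · exact (hc.comap_glue_right β₁ β₂).ge.trans (comap_mono _ _ le_sup_right)

theorem glue_next_left (α₁ : NCPartition m) (α₂ : NCPartition k) (x : Fin m) :
    (hc.glue α₁ α₂).next (f x) = f (α₁.next x) := by
  rw [comap_next_of_closed hc.left_strictMono, comap_glue_left]
  intro x z hr
  rcases hc.cover z with hz | ⟨y, rfl⟩
  · exact hz
  · exact (hc.not_glue_rel _ _ hr).elim

theorem glue_next_right (α₁ : NCPartition m) (α₂ : NCPartition k) (y : Fin k) :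
    (hc.glue α₁ α₂).next (h y) = h (α₂.next y) := by
  rw [comap_next_of_closed hc.right_strictMono, comap_glue_right]
  intro x z hr
  rcases hc.cover z with ⟨y, rfl⟩ | hz
  · exact (hc.not_glue_rel _ _ (Setoid.symm' _ hr)).elim
  · exact hz

theorem ncDist_glue (α₁ β₁ : NCPartition m) (α₂ β₂ : NCPartition k) :
    ncDist (hc.glue α₁ α₂) (hc.glue β₁ β₂) = ncDist α₁ β₁ + ncDist α₂ β₂ := by
  refine permLength_eq_add_of_complementary hc.left_strictMono.injective
    hc.right_strictMono.injective hc.disjoint hc.cover ?_ ?_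
  · intro x
    rw [Equiv.Perm.mul_apply, Equiv.Perm.inv_eq_iff_eq, toPerm_apply, toPerm_apply,
      glue_next_left, glue_next_left, ← toPerm_apply, ← toPerm_apply, ← Equiv.Perm.mul_apply,
      mul_inv_cancel_left]
  · intro x
    rw [Equiv.Perm.mul_apply, Equiv.Perm.inv_eq_iff_eq, toPerm_apply, toPerm_apply,
      glue_next_right, glue_next_right, ← toPerm_apply, ← toPerm_apply, ← Equiv.Perm.mul_apply,
      mul_inv_cancel_left]

end IntervalCut

/-! ### Contraction of common successors -/

namespace NCPartition

variable {n : ℕ}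

/-- After the deletion of `i`, the predecessor of `i` in its block is followed by the successor
of `i`. -/
theorem succAbove_comap_next (α : NCPartition (n + 1)) (i : Fin (n + 1)) (u : Fin n) :
    i.succAbove ((α.comap i.succAbove i.strictMono_succAbove).next u) =
      if α.next (i.succAbove u) = i then α.next i else α.next (i.succAbove u) := by
  have hmono := i.strictMono_succAbove
  have hne := i.succAbove_ne u
  have hcov : ∀ z, z ≠ i → ∃ v, i.succAbove v = z := fun z hz => Fin.exists_succAbove_eq hz
  suffices h : ∀ w, (if α.next (i.succAbove u) = i then α.next i else α.next (i.succAbove u)) = w →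
      i.succAbove ((α.comap i.succAbove hmono).next u) = w from h _ rfl
  intro w hw
  obtain ⟨h1, h2⟩ := α.next_spec (i.succAbove u)
  split_ifs at hw with hi
  · rw [hi] at h1 h2
    obtain ⟨h3, h4⟩ := α.next_spec i
    rw [hw] at h3 h4
    have hwi : w ≠ i := by
      rintro rfl
      exact hne (α.next_injective (hi.trans hw.symm))
    obtain ⟨v, rfl⟩ := hcov w hwi
    congr 1
    rw [next_eq_iff]
    refine ⟨α.rel.trans h1 h3, ?_⟩
    have hrel : ∀ x, (α.comap i.succAbove hmono).rel u x → α.rel i (i.succAbove x) :=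
      fun x hx => α.rel.trans (α.rel.symm h1) hx
    rcases h2 with ⟨h2, h2'⟩ | ⟨h2, h2'⟩ <;> rcases h4 with ⟨h4, h4'⟩ | ⟨h4, h4'⟩
    · refine Or.inl ⟨hmono.lt_iff_lt.1 (h2.trans h4), fun x hx hux => ?_⟩
      have := h2' _ hx (hmono hux)
      exact hmono.le_iff_le.1
        (h4' _ (hrel x hx) (lt_of_le_of_ne this (i.succAbove_ne x).symm))
    · refine Or.inr ⟨hmono.le_iff_le.1 (h4' _ (α.rel.symm h1)).1, fun x hx => ?_⟩
      refine ⟨hmono.le_iff_le.1 (h4' _ (hrel x hx)).1, ?_⟩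
      by_contra hux
      have := h2' _ hx (hmono (not_le.1 hux))
      exact i.succAbove_ne x (le_antisymm (h4' _ (hrel x hx)).2 this)
    · refine Or.inr ⟨hmono.le_iff_le.1 (h4' _ (α.rel.symm h1) (lt_of_le_of_ne h2 hne.symm)),
        fun x hx => ?_⟩
      refine ⟨hmono.le_iff_le.1 (h4' _ (hrel x hx) ?_), hmono.le_iff_le.1 (h2' _ hx).2⟩
      exact lt_of_le_of_ne (h2' _ hx).1 (i.succAbove_ne x).symm
    · exact absurd (le_antisymm (h4' _ (α.rel.symm h1)).2 h2) hne
  · rw [hw] at h1 h2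
    obtain ⟨v, rfl⟩ := hcov w (hw ▸ hi)
    congr 1
    rw [next_eq_iff]
    refine ⟨h1, h2.imp ?_ ?_⟩
    · exact fun ⟨h, h'⟩ => ⟨hmono.lt_iff_lt.1 h,
        fun x hx hux => hmono.le_iff_le.1 (h' _ hx (hmono hux))⟩
    · exact fun ⟨h, h'⟩ => ⟨hmono.le_iff_le.1 h,
        fun x hx => ⟨hmono.le_iff_le.1 (h' _ hx).1, hmono.le_iff_le.1 (h' _ hx).2⟩⟩

/-- Deleting a fixed point of `α⁻¹ β` restricts this permutation to the remaining points. -/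
theorem inv_mul_toPerm_succAbove {α β : NCPartition (n + 1)} {i : Fin (n + 1)}
    (hi : α.next i = β.next i) (u : Fin n) :
    (α.toPerm⁻¹ * β.toPerm) (i.succAbove u) =
      i.succAbove (((α.comap i.succAbove i.strictMono_succAbove).toPerm⁻¹ *
        (β.comap i.succAbove i.strictMono_succAbove).toPerm) u) := by
  set v := ((α.comap i.succAbove i.strictMono_succAbove).toPerm⁻¹ *
        (β.comap i.succAbove i.strictMono_succAbove).toPerm) u with hv
  rw [Equiv.Perm.mul_apply, Equiv.Perm.eq_inv_iff_eq, toPerm_apply, toPerm_apply] at hv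
  have h := congrArg i.succAbove hv
  rw [succAbove_comap_next, succAbove_comap_next] at h
  rw [Equiv.Perm.mul_apply, Equiv.Perm.inv_eq_iff_eq, toPerm_apply, toPerm_apply]
  split_ifs at h with h1 h2 h2
  · rw [h1, h2]
  · rw [hi] at h
    exact (i.succAbove_ne _ (β.next_injective h).symm).elim
  · rw [← hi] at h
    exact (i.succAbove_ne _ (α.next_injective h)).elim
  · exact h.symm

theorem inv_mul_toPerm_apply_eq_self_iff {n : ℕ} {α β : NCPartition n} {i : Fin n} :
    (α.toPerm⁻¹ * β.toPerm) i = i ↔ α.next i = β.next i := by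
  rw [Equiv.Perm.mul_apply, Equiv.Perm.inv_eq_iff_eq, toPerm_apply, toPerm_apply, eq_comm]

/-- Deleting a fixed point of `α⁻¹ β` does not change the distance of `α` and `β`. -/
theorem ncDist_comap_succAbove {α β : NCPartition (n + 1)} {i : Fin (n + 1)}
    (hi : α.next i = β.next i) :
    ncDist (α.comap i.succAbove i.strictMono_succAbove)
      (β.comap i.succAbove i.strictMono_succAbove) = ncDist α β := by
  have h := permLength_eq_add_of_complementary (f := i.succAbove) (h := fun _ : Fin 1 => i)
    (σ := α.toPerm⁻¹ * β.toPerm) (σ₂ := 1) i.strictMono_succAbove.injective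
    (Function.injective_of_subsingleton _) (fun x _ => i.succAbove_ne x)
    (fun z => (eq_or_ne z i).symm.imp (fun hz => Fin.exists_succAbove_eq hz)
      fun hz => ⟨0, hz.symm⟩)
    (inv_mul_toPerm_succAbove hi) (fun _ => inv_mul_toPerm_apply_eq_self_iff.2 hi)
  rw [permLength_one, add_zero] at h
  exact h.symm

/-- The non-crossing partition into an interval and its complement. -/
def twoBlock (T : Set (Fin n)) (hT : T.OrdConnected) : NCPartition n where
  rel :=
    { r := fun x y => x ∈ T ↔ y ∈ T
      iseqv := ⟨fun _ => Iff.rfl, fun h => h.symm, fun h h' => h.trans h'⟩ }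
  noncrossing a c b d hac hcb hbd hab hcd := by
    refine ⟨fun ha => hT.out ha (hab.1 ha) ⟨hac.le, hcb.le⟩, fun hc => ?_⟩
    exact hab.2 (hT.out hc (hcd.1 hc) ⟨hcb.le, hbd.le⟩)

theorem le_twoBlock {T : Set (Fin n)} (hT : T.OrdConnected) {α : NCPartition n}
    (h : ∀ x y, x ∈ T → α.rel x y → y ∈ T) : α ≤ twoBlock T hT :=
  le_of_rel fun x y hxy => ⟨fun hx => h x y hx hxy, fun hy => h y x hy (α.rel.symm hxy)⟩

/-- An interval that is a union of blocks of `α` and of `β` is everything or empty if `α ⊔ β` has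
a single block. -/
theorem mem_of_sup_eq_top {α β : NCPartition n} (hαβ : α ⊔ β = ⊤) {T : Set (Fin n)}
    (hT : T.OrdConnected) (hα : ∀ x y, x ∈ T → α.rel x y → y ∈ T)
    (hβ : ∀ x y, x ∈ T → β.rel x y → y ∈ T) {x : Fin n} (hx : x ∈ T) (y : Fin n) : y ∈ T := by
  have h : (⊤ : NCPartition n) ≤ twoBlock T hT :=
    hαβ ▸ sup_le (le_twoBlock hT hα) (le_twoBlock hT hβ)
  exact (rel_of_le h (top_rel x y)).1 hx

theorem closed_Ioo_next {α : NCPartition n} {i c : Fin n} (hc : α.next i = c) (hic : i < c)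
    (x y : Fin n) (hx : x ∈ Set.Ioo i c) (hxy : α.rel x y) : y ∈ Set.Ioo i c := by
  obtain ⟨h1, h2 | h2⟩ := (next_eq_iff _ _ _).1 hc
  swap
  · exact absurd h2.1 (not_le.2 hic)
  have hix : ¬ α.rel i x := fun h => absurd (h2.2 x h hx.1) (not_le.2 hx.2)
  by_contra hy
  rcases lt_trichotomy y i with h | rfl | h
  · have := α.noncrossing y i x c h hx.1 hx.2 (α.rel.symm hxy) h1
    exact hix (α.rel.symm (α.rel.trans hxy this))
  · exact hix (α.rel.symm hxy)
  rcases lt_trichotomy y c with h' | rfl | h'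
  · exact hy ⟨h, h'⟩
  · exact hix (α.rel.trans h1 (α.rel.symm hxy))
  · exact hix (α.noncrossing i x c y hx.1 hx.2 h' h1 hxy)

theorem closed_Icc_next {α : NCPartition n} {i c : Fin n} (hc : α.next i = c) (hci : c ≤ i)
    (x y : Fin n) (hx : x ∈ Set.Icc c i) (hxy : α.rel x y) : y ∈ Set.Icc c i := by
  obtain ⟨h1, h2 | h2⟩ := (next_eq_iff _ _ _).1 hc
  · exact absurd hci (not_le.2 h2.1)
  by_contra hy
  have hiy : ¬ α.rel i y := fun h => hy (h2.2 y h)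
  have hxc : x ≠ c := by rintro rfl; exact hiy (α.rel.trans h1 hxy)
  have hxi : x ≠ i := by rintro rfl; exact hiy hxy
  have hcx := lt_of_le_of_ne hx.1 hxc.symm
  have hxi' := lt_of_le_of_ne hx.2 hxi
  rcases lt_or_ge y c with h | h
  · exact hiy (α.rel.trans h1
      (α.rel.symm (α.noncrossing y c x i h hcx hxi' (α.rel.symm hxy) (α.rel.symm h1))))
  · have hiy' : i < y := not_le.1 fun h' => hy ⟨h, h'⟩
    have := α.noncrossing c x i y hcx hxi' hiy' (α.rel.symm h1) hxy
    exact hiy (α.rel.trans h1 (α.rel.trans this hxy))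

/-- If the join is the one-block partition, two equal successors can only be the cyclic
successor: otherwise the points enclosed by the common arc would be cut off. -/
theorem next_eq_add_one_of_sup_eq_top {α β : NCPartition (n + 1)} (hαβ : α ⊔ β = ⊤)
    {i : Fin (n + 1)} (hi : α.next i = β.next i) : α.next i = i + 1 := by
  obtain ⟨c, hc⟩ : ∃ c, α.next i = c := ⟨_, rfl⟩
  have hc' := hi.symm.trans hc
  rw [hc]
  rcases lt_or_ge i c with hic | hic
  · have hil : i ≠ Fin.last n := fun h => absurd (Fin.le_last c) (not_le.2 (h ▸ hic))
    have hv : ((i + 1 : Fin (n + 1)) : ℕ) = i + 1 := by rw [Fin.val_add_one, if_neg hil]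
    by_contra hne
    have hmem : i + 1 ∈ Set.Ioo i c := by
      have : (c : ℕ) ≠ i + 1 := fun h => hne (Fin.ext (h.trans hv.symm))
      constructor
      · rw [Fin.lt_def, hv]; omega
      · rw [Fin.lt_def, hv]; rw [Fin.lt_def] at hic; omega
    exact lt_irrefl i (mem_of_sup_eq_top hαβ Set.ordConnected_Ioo (closed_Ioo_next hc hic)
      (closed_Ioo_next hc' hic) hmem i).1
  · have hall := mem_of_sup_eq_top hαβ Set.ordConnected_Icc (closed_Icc_next hc hic)
      (closed_Icc_next hc' hic) (Set.right_mem_Icc.2 hic)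
    have h0 : c = 0 := le_antisymm (hall 0).1 (Fin.zero_le _)
    have hl : i = Fin.last n := le_antisymm (Fin.le_last _) (hall _).2
    rw [h0, hl, Fin.last_add_one]

theorem next_eq_add_one {α : NCPartition (n + 1)} {i : Fin (n + 1)} (h : α.rel i (i + 1)) :
    α.next i = i + 1 := by
  rw [next_eq_iff]
  refine ⟨h, ?_⟩
  by_cases hil : i = Fin.last n
  · right
    rw [hil, Fin.last_add_one]
    exact ⟨Fin.zero_le _, fun x _ => ⟨Fin.zero_le _, Fin.le_last _⟩⟩
  · left
    have hv : ((i + 1 : Fin (n + 1)) : ℕ) = i + 1 := by rw [Fin.val_add_one, if_neg hil]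
    refine ⟨by rw [Fin.lt_def, hv]; omega, fun x _ hx => ?_⟩
    rw [Fin.le_def, hv]
    exact hx

/-- The left inverse of `i.succAbove` contracting `i` to its cyclic successor; in particular it
sends the last point to `0` when `i` is the last point. -/
def contract (i x : Fin (n + 2)) : Fin (n + 1) :=
  ⟨if (x : ℕ) ≤ i then (if (x : ℕ) = n + 1 then 0 else x) else x - 1, by split_ifs <;> omega⟩

theorem contract_succAbove (i : Fin (n + 2)) (u : Fin (n + 1)) :
    contract i (i.succAbove u) = u := by
  ext
  simp only [contract, Fin.succAbove, Fin.lt_def]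
  split_ifs with h1 h2 h3 h2 h3 <;> simp_all <;> omega

theorem succAbove_contract (i x : Fin (n + 2)) :
    i.succAbove (contract i x) = if x = i then i + 1 else x := by
  by_cases hx : x = i
  · subst hx
    rw [if_pos rfl]
    ext
    rw [Fin.val_add_one]
    simp only [contract, Fin.succAbove, Fin.lt_def, Fin.ext_iff, Fin.val_last,
      le_refl, if_true]
    split_ifs <;> simp_all
  · rw [if_neg hx]
    obtain ⟨u, rfl⟩ := Fin.exists_succAbove_eq hx
    rw [contract_succAbove]

/-- Insertion of a new point `i` into the block of its cyclic successor. -/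
def insertPoint (i : Fin (n + 2)) (α : NCPartition (n + 1)) : NCPartition (n + 2) where
  rel := α.rel.comap (contract i)
  noncrossing a c b d hac hcb hbd hab hcd := by
    change α.rel _ _ at hab
    change α.rel _ _ at hcd
    change α.rel _ _
    rw [Fin.lt_def] at hac hcb hbd
    by_cases hd : d ≤ i ∧ (d : ℕ) = n + 1
    -- here `d = i` is the last point and is contracted to `0`
    · have e0 : contract i d = 0 := by
        ext
        change (if (d : ℕ) ≤ i then (if (d : ℕ) = n + 1 then 0 else (d : ℕ)) else d - 1) = 0
        rw [if_pos (Fin.le_def.1 hd.1), if_pos hd.2]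
      have e : ∀ x : Fin (n + 2), (x : ℕ) < d → (contract i x : ℕ) = x := by
        intro x hx
        have := Fin.le_def.1 hd.1
        simp only [contract]
        split_ifs <;> omega
      rw [e0] at hcd
      have ea := e a (by omega)
      have eb := e b (by omega)
      have ec := e c (by omega)
      by_cases ha : (a : ℕ) = 0
      · have : contract i a = 0 := Fin.ext (by rw [ea, ha]; rfl)
        rw [this]
        exact α.rel.symm hcd
      · have h := α.noncrossing 0 (contract i a) (contract i c) (contract i b)
          (by rw [Fin.lt_def, ea]; exact Nat.pos_of_ne_zero ha) (by rw [Fin.lt_def]; omega)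
          (by rw [Fin.lt_def]; omega) (α.rel.symm hcd) hab
        exact α.rel.trans (α.rel.symm h) (α.rel.symm hcd)
    · have hmono : ∀ x y : Fin (n + 2), x < y → y ≤ d → contract i x ≤ contract i y := by
        intro x y hxy hyd
        rw [Fin.lt_def] at hxy
        rw [Fin.le_def] at hyd hd
        rw [Fin.le_def]
        simp only [contract]
        split_ifs <;> omega
      rcases (hmono a c hac (by rw [Fin.le_def]; omega)).eq_or_lt with h1 | h1
      · rw [h1]
      rcases (hmono c b hcb hbd.le).eq_or_lt with h2 | h2
      · rw [h2]; exact hab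
      rcases (hmono b d hbd le_rfl).eq_or_lt with h3 | h3
      · rw [h3] at hab; exact α.rel.trans hab (α.rel.symm hcd)
      exact α.noncrossing _ _ _ _ h1 h2 h3 hab hcd

theorem insertPoint_mono (i : Fin (n + 2)) {α β : NCPartition (n + 1)} (h : α ≤ β) :
    insertPoint i α ≤ insertPoint i β :=
  le_of_rel fun _ _ hxy => rel_of_le h hxy

theorem comap_insertPoint (i : Fin (n + 2)) (α : NCPartition (n + 1)) :
    (insertPoint i α).comap i.succAbove i.strictMono_succAbove = α := by
  refine ext_rel fun x y => ?_
  change α.rel (contract i _) (contract i _) ↔ _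
  rw [contract_succAbove, contract_succAbove]

theorem insertPoint_comap {i : Fin (n + 2)} {α : NCPartition (n + 2)} (h : α.rel i (i + 1)) :
    insertPoint i (α.comap i.succAbove i.strictMono_succAbove) = α := by
  have key : ∀ x, α.rel x (i.succAbove (contract i x)) := by
    intro x
    rw [succAbove_contract]
    split_ifs with hx
    · rwa [hx]
    · exact α.rel.refl x
  refine ext_rel fun x y => ?_
  change α.rel (i.succAbove _) (i.succAbove _) ↔ _
  exact ⟨fun hr => α.rel.trans (key x) (α.rel.trans hr (α.rel.symm (key y))),
    fun hr => α.rel.trans (α.rel.symm (key x)) (α.rel.trans hr (key y))⟩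

theorem insertPoint_rel (i : Fin (n + 2)) (α : NCPartition (n + 1)) :
    (insertPoint i α).rel i (i + 1) := by
  have h := succAbove_contract i i
  rw [if_pos rfl] at h
  change α.rel (contract i i) (contract i (i + 1))
  rw [← h, contract_succAbove]

theorem comap_top {m : ℕ} (f : Fin m → Fin n) (hf : StrictMono f) :
    (⊤ : NCPartition n).comap f hf = ⊤ :=
  eq_top_of_rel fun _ _ => top_rel _ _

theorem insertPoint_sup_eq_top_iff (i : Fin (n + 2)) (α β : NCPartition (n + 1)) :
    insertPoint i α ⊔ insertPoint i β = ⊤ ↔ α ⊔ β = ⊤ := by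
  constructor
  · intro h
    have h' : insertPoint i (α ⊔ β) = ⊤ := top_le_iff.1 <| h ▸
      sup_le (insertPoint_mono i le_sup_left) (insertPoint_mono i le_sup_right)
    rw [← comap_insertPoint i (α ⊔ β), h', comap_top]
  · intro h
    have hrel : (insertPoint i α ⊔ insertPoint i β).rel i (i + 1) :=
      rel_of_le le_sup_left (insertPoint_rel i α)
    have hle : α ⊔ β ≤
        (insertPoint i α ⊔ insertPoint i β).comap i.succAbove i.strictMono_succAbove :=
      sup_le ((comap_insertPoint i α).ge.trans (comap_mono _ _ le_sup_left))
        ((comap_insertPoint i β).ge.trans (comap_mono _ _ le_sup_right))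
    rw [h, top_le_iff] at hle
    rw [← insertPoint_comap hrel, hle]
    exact eq_top_of_rel fun _ _ => top_rel _ _

end NCPartition

/-! ### Generating polynomials of pairs of partitions -/

/-- The ring `ℚ[Y, A, B]`, in which `Y ^ r * A ^ a * B ^ b` is `single (r, a, b) 1`. -/
abbrev WeightRing : Type := AddMonoidAlgebra ℚ (ℕ × ℕ × ℕ)

namespace NCPartition

variable {n m k : ℕ}

noncomputable instance : Fintype (NCPartition n) := Fintype.ofFinite _

/-- The monomial `Y ^ r * A ^ a * B ^ b` of a pair lying in `meandricPairs n r a b`. -/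
noncomputable def weight (p : NCPartition n × NCPartition n) : WeightRing :=
  AddMonoidAlgebra.single
    (ncDist p.1 p.2, ncDist p.1 (p.1 ⊔ p.2), ncDist p.2 (p.1 ⊔ p.2)) 1

theorem coeff_weight (p : NCPartition n × NCPartition n) (r a b : ℕ)
    [Decidable (p ∈ meandricPairs n r a b)] :
    (weight p).coeff (r, a, b) = if p ∈ meandricPairs n r a b then 1 else 0 := by
  classical
  rw [weight, AddMonoidAlgebra.coeff_single, Finsupp.single_apply]
  refine if_congr ?_ rfl rfl
  rw [Prod.mk.injEq, Prod.mk.injEq]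
  rfl

theorem weight_glue {f : Fin m → Fin n} {h : Fin k → Fin n} (hc : IntervalCut f h)
    (p : NCPartition m × NCPartition m) (q : NCPartition k × NCPartition k) :
    weight (hc.glue p.1 q.1, hc.glue p.2 q.2) = weight p * weight q := by
  simp only [weight, hc.glue_sup_glue, hc.ncDist_glue, AddMonoidAlgebra.single_mul_single,
    Prod.mk_add_mk, mul_one]

/-- The generating polynomial of all pairs of non-crossing partitions of `n` points. -/
noncomputable def pairSum (n : ℕ) : WeightRing := ∑ p : NCPartition n × NCPartition n, weight p

theorem coeff_pairSum (n r a b : ℕ) :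
    (pairSum n).coeff (r, a, b) = ((meandricPairs n r a b).ncard : ℚ) := by
  classical
  simp only [pairSum, AddMonoidAlgebra.coeff_sum, Finsupp.finsetSum_apply, coeff_weight]
  rw [Finset.sum_boole, Set.ncard_eq_toFinset_card']
  congr 2
  ext p
  simp

/-- The last `t` points all lie in the block of the first point. -/
def TailInFirstBlock (t : ℕ) (γ : NCPartition n) : Prop :=
  ∀ z x : Fin n, (z : ℕ) = 0 → n ≤ x + t → γ.rel z x

open Classical in
/-- The generating polynomial of the pairs of partitions of `n ≥ t` points for which the last `t`
points lie in the block of the first point in the join. -/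
noncomputable def tailSum (t n : ℕ) : WeightRing :=
  if t ≤ n then
    ∑ p : NCPartition n × NCPartition n with TailInFirstBlock t (p.1 ⊔ p.2), weight p
  else 0

open Classical in
/-- The generating polynomial of the pairs of partitions whose join has a single block. -/
noncomputable def irreducibleSum (n : ℕ) : WeightRing :=
  ∑ p : NCPartition n × NCPartition n with p.1 ⊔ p.2 = ⊤, weight p

theorem tailSum_zero (n : ℕ) : tailSum 0 n = pairSum n := by
  classical
  rw [tailSum, if_pos (Nat.zero_le n), pairSum, Finset.filter_true_of_mem]
  intro p _ z x _ h
  omega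

theorem tailSum_self (n : ℕ) : tailSum n n = irreducibleSum n := by
  classical
  rw [tailSum, if_pos le_rfl, irreducibleSum]
  congr 1
  refine Finset.filter_congr fun p _ => ⟨fun h => ?_, fun h => ?_⟩
  · refine eq_top_of_rel fun x y => ?_
    have hz := fun x => h ⟨0, x.pos⟩ x rfl (by omega)
    exact Setoid.trans' _ (Setoid.symm' _ (hz x)) (hz y)
  · rw [h]
    exact fun _ _ _ _ => top_rel _ _

theorem tailSum_of_lt {t n : ℕ} (h : n < t) : tailSum t n = 0 := if_neg (not_le.2 h)

/-- The points `m - t, …, m - t + g - 1` of `Fin (g + m)` form an interval of length `g`, followed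
by `t` points. -/
theorem intervalCut_before_tail {g m t : ℕ} (ht : t ≤ m) :
    IntervalCut
      (fun x : Fin m => (⟨if (x : ℕ) + t < m then x else x + g, by split_ifs <;> omega⟩ :
        Fin (g + m)))
      (fun y : Fin g => (⟨y + (m - t), by omega⟩ : Fin (g + m))) where
  left_strictMono x y h := by
    rw [Fin.lt_def] at h ⊢
    dsimp only
    split_ifs <;> omega
  right_strictMono x y h := by
    rw [Fin.lt_def] at h ⊢
    dsimp only
    omega
  disjoint x y h := by
    rw [Fin.ext_iff] at h
    dsimp only at h
    split_ifs at h <;> omega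
  cover z := by
    rcases lt_or_ge ((z : ℕ) + t) m with h | h
    · exact Or.inl ⟨⟨z, by omega⟩, Fin.ext (if_pos h)⟩
    rcases lt_or_ge ((z : ℕ) + t) (g + m) with h' | h'
    · exact Or.inr ⟨⟨z - (m - t), by omega⟩, Fin.ext (Nat.sub_add_cancel (by omega))⟩
    · refine Or.inl ⟨⟨z - g, by omega⟩, Fin.ext ?_⟩
      dsimp only
      rw [if_neg (by omega)]
      omega
  convex y₁ y₂ z h₁ h₂ := by
    rw [Fin.lt_def] at h₁ h₂
    dsimp only at h₁ h₂
    exact ⟨⟨z - (m - t), by omega⟩, Fin.ext (Nat.sub_add_cancel (by omega))⟩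

/-- The last `t` points and the point at position `m - t - 1` lie in the block of the first point,
and no point strictly between them does. -/
def TailGap (t m : ℕ) (γ : NCPartition n) : Prop :=
  TailInFirstBlock t γ ∧ (∀ z x : Fin n, (z : ℕ) = 0 → (x : ℕ) + t + 1 = m → γ.rel z x) ∧
    ∀ z x : Fin n, (z : ℕ) = 0 → m ≤ x + t → x + t < n → ¬ γ.rel z x

/-- The `g` points between position `m - t - 1` and the last `t` points are a union of blocks of the
join, by the non-crossing condition. -/
theorem sum_tailGap {g m t : ℕ} (ht : t + 1 ≤ m)
    [DecidablePred fun p : NCPartition (g + m) × NCPartition (g + m) =>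
      TailGap t m (p.1 ⊔ p.2)] :
    ∑ p : NCPartition (g + m) × NCPartition (g + m) with TailGap t m (p.1 ⊔ p.2), weight p =
      pairSum g * tailSum (t + 1) m := by
  classical
  obtain ⟨f, hf⟩ : ∃ f : Fin m → Fin (g + m), f = fun x : Fin m =>
    (⟨if (x : ℕ) + t < m then x else x + g, by split_ifs <;> omega⟩ : Fin (g + m)) := ⟨_, rfl⟩
  obtain ⟨h, hh⟩ : ∃ h : Fin g → Fin (g + m), h = fun y : Fin g =>
    (⟨y + (m - t), by omega⟩ : Fin (g + m)) := ⟨_, rfl⟩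
  have hc : IntervalCut f h := by
    rw [hf, hh]
    exact intervalCut_before_tail (by omega)
  have hfv : ∀ x : Fin m, (f x : ℕ) = if (x : ℕ) + t < m then (x : ℕ) else x + g := by
    intro x; rw [hf]
  have hhv : ∀ y : Fin g, (h y : ℕ) = y + (m - t) := by
    intro y; rw [hh]
  have hf0 : ∀ z : Fin (g + m), (z : ℕ) = 0 → z = f ⟨0, by omega⟩ := by
    intro z hz
    ext
    rw [hfv, hz]
    exact (if_pos (by dsimp only; omega)).symm
  have hsep : ∀ γ : NCPartition (g + m), TailGap t m γ → ∀ x y, ¬ γ.rel (f x) (h y) := by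
    rintro γ ⟨h1, h2, h3⟩ x y hr
    have hyt : (y : ℕ) < g := y.2
    have hx0 : ¬ γ.rel ⟨0, by omega⟩ (f x) := fun h0 =>
      h3 ⟨0, by omega⟩ (h y) rfl (by rw [hhv]; omega) (by rw [hhv]; omega) (γ.rel.trans h0 hr)
    have hu : γ.rel ⟨0, by omega⟩ ⟨m - t - 1, by omega⟩ := h2 _ _ rfl (by dsimp only; omega)
    by_cases hxt : (x : ℕ) + t < m
    · have e : (f x : ℕ) = x := by rw [hfv, if_pos hxt]
      have ne0 : (f x : ℕ) ≠ 0 := fun h0 => hx0 (by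
        rw [show f x = ⟨0, by omega⟩ from Fin.ext h0])
      have neu : (f x : ℕ) ≠ m - t - 1 := fun h0 => hx0 (by
        rw [show f x = ⟨m - t - 1, by omega⟩ from Fin.ext h0]; exact hu)
      refine hx0 (γ.noncrossing _ (f x) ⟨m - t - 1, by omega⟩ (h y) ?_ ?_ ?_ hu hr)
      · rw [Fin.lt_def]; dsimp only; omega
      · rw [Fin.lt_def]; dsimp only; omega
      · rw [Fin.lt_def, hhv]; dsimp only; omega
    · exact hx0 (h1 _ _ rfl (by rw [hfv, if_neg hxt]; omega))
  have hglue : ∀ (γ₁ : NCPartition m) (γ₂ : NCPartition g),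
      TailGap t m (hc.glue γ₁ γ₂) ↔ TailInFirstBlock (t + 1) γ₁ := by
    intro γ₁ γ₂
    constructor
    · rintro ⟨h1, h2, h3⟩ z x hz hx
      rw [← hc.glue_rel_left (α₂ := γ₂)]
      have hfz : (f z : ℕ) = 0 := by rw [hfv, if_pos (by omega), hz]
      by_cases hxt : (x : ℕ) + t < m
      · exact h2 _ _ hfz (by rw [hfv, if_pos hxt]; omega)
      · exact h1 _ _ hfz (by rw [hfv, if_neg hxt]; omega)
    · intro h1
      refine ⟨fun z x hz hx => ?_, fun z x hz hx => ?_, fun z x hz hx hx' hr => ?_⟩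
      all_goals
        rcases hc.cover x with ⟨x, rfl⟩ | ⟨x, rfl⟩
      · rw [hf0 z hz, hc.glue_rel_left]
        rw [hfv] at hx
        exact h1 _ _ rfl (by split_ifs at hx <;> omega)
      · rw [hhv] at hx; omega
      · rw [hf0 z hz, hc.glue_rel_left]
        rw [hfv] at hx
        exact h1 _ _ rfl (by split_ifs at hx <;> omega)
      · rw [hhv] at hx; omega
      · rw [hfv] at hx hx'
        split_ifs at hx hx' <;> omega
      · rw [hf0 z hz] at hr
        exact hc.not_glue_rel _ _ hr
  rw [tailSum, if_pos ht, mul_comm, pairSum, Finset.sum_mul_sum, ← Finset.sum_product']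
  refine Finset.sum_nbij'
    (fun p => ((p.1.comap f hc.left_strictMono, p.2.comap f hc.left_strictMono),
      (p.1.comap h hc.right_strictMono, p.2.comap h hc.right_strictMono)))
    (fun q => (hc.glue q.1.1 q.2.1, hc.glue q.1.2 q.2.2)) ?_ ?_ ?_ ?_ ?_
  all_goals
    have hsplit : ∀ p : NCPartition (g + m) × NCPartition (g + m), TailGap t m (p.1 ⊔ p.2) →
        hc.glue (p.1.comap f hc.left_strictMono) (p.1.comap h hc.right_strictMono) = p.1 ∧
        hc.glue (p.2.comap f hc.left_strictMono) (p.2.comap h hc.right_strictMono) = p.2 :=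
      fun p hp => ⟨hc.glue_comap fun x y hr => hsep _ hp x y (rel_of_le le_sup_left hr),
        hc.glue_comap fun x y hr => hsep _ hp x y (rel_of_le le_sup_right hr)⟩
  · intro p hp
    have hp' := (Finset.mem_filter.1 hp).2
    obtain ⟨h1, h2⟩ := hsplit p hp'
    rw [← h1, ← h2, hc.glue_sup_glue, hglue] at hp'
    simpa only [Finset.mem_product, Finset.mem_filter, Finset.mem_univ, true_and,
      and_true] using hp'
  · intro q hq
    simp only [Finset.mem_product, Finset.mem_filter, Finset.mem_univ, true_and, and_true] at hq
    rw [Finset.mem_filter]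
    refine ⟨Finset.mem_univ _, ?_⟩
    dsimp only
    rwa [hc.glue_sup_glue, hglue]
  · intro p hp
    obtain ⟨h1, h2⟩ := hsplit p (Finset.mem_filter.1 hp).2
    exact Prod.ext h1 h2
  · intro q _
    simp only [hc.comap_glue_left, hc.comap_glue_right]
  · intro p hp
    obtain ⟨h1, h2⟩ := hsplit p (Finset.mem_filter.1 hp).2
    rw [← weight_glue hc]
    dsimp only
    rw [h1, h2]

/-- The points outside the first block that come right before the last `t` points can be removed
together with the restriction of the pair to them. -/
theorem tailSum_eq_sum_antidiagonal {t n : ℕ} (htn : t < n) :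
    tailSum t n =
      ∑ gm ∈ Finset.HasAntidiagonal.antidiagonal n, pairSum gm.1 * tailSum (t + 1) gm.2 := by
  classical
  -- the position of the last point of the first block among those before the last `t` points
  let P : NCPartition n → ℕ → Prop := fun γ u =>
    u + t < n ∧ ∀ z x : Fin n, (z : ℕ) = 0 → (x : ℕ) = u → γ.rel z x
  let μ : NCPartition n → ℕ := fun γ => Nat.findGreatest (P γ) n
  have hP0 : ∀ γ, P γ 0 := fun γ => ⟨by omega, fun z x hz hx => by
    rw [show z = x from Fin.ext (hz.trans hx.symm)]⟩
  have hPμ : ∀ γ, P γ (μ γ) := fun γ => Nat.findGreatest_spec (Nat.zero_le n) (hP0 γ)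
  have hmax : ∀ γ u, P γ u → u ≤ μ γ := fun γ u hu =>
    Nat.le_findGreatest (by have := hu.1; omega) hu
  have hiff : ∀ γ m, t + 1 ≤ m → m ≤ n →
      ((TailInFirstBlock t γ ∧ μ γ + t + 1 = m) ↔ TailGap t m γ) := by
    intro γ m h1 h2
    constructor
    · rintro ⟨h3, rfl⟩
      refine ⟨h3, fun z x hz hx => (hPμ γ).2 z x hz (by omega), fun z x hz hx hx' hr => ?_⟩
      have := hmax γ x ⟨hx', fun z' x' hz' hx'' => by
        rwa [show z' = z from Fin.ext (hz'.trans hz.symm), show x' = x from Fin.ext hx'']⟩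
      omega
    · rintro ⟨h3, h4, h5⟩
      refine ⟨h3, ?_⟩
      have hle : m - t - 1 ≤ μ γ :=
        hmax γ _ ⟨by omega, fun z x hz hx => h4 z x hz (by omega)⟩
      by_contra hne
      have hlt := (hPμ γ).1
      exact h5 ⟨0, by omega⟩ ⟨μ γ, by omega⟩ rfl (by dsimp only; omega) hlt ((hPμ γ).2 _ _ rfl rfl)
  rw [tailSum, if_pos htn.le, ← Finset.sum_fiberwise_of_maps_to
    (t := Finset.HasAntidiagonal.antidiagonal n)
    (g := fun p => (n - (μ (p.1 ⊔ p.2) + t + 1), μ (p.1 ⊔ p.2) + t + 1))]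
  swap
  · intro p _
    have := (hPμ (p.1 ⊔ p.2)).1
    rw [Finset.HasAntidiagonal.mem_antidiagonal]
    dsimp only
    omega
  refine Finset.sum_congr rfl fun gm hgm => ?_
  obtain ⟨g, m⟩ := gm
  rw [Finset.HasAntidiagonal.mem_antidiagonal] at hgm
  dsimp only at hgm ⊢
  rw [Finset.filter_filter]
  by_cases hm : t + 1 ≤ m
  · subst hgm
    rw [← sum_tailGap hm]
    refine Finset.sum_congr (Finset.filter_congr fun p _ => ?_) fun _ _ => rfl
    rw [← hiff (p.1 ⊔ p.2) m hm (by omega), Prod.mk.injEq]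
    refine and_congr_right fun _ => ⟨fun h => h.2, fun h => ⟨by omega, h⟩⟩
  · rw [tailSum_of_lt (by omega), mul_zero]
    refine Finset.sum_eq_zero fun p hp => ?_
    have := congrArg Prod.snd (Finset.mem_filter.1 hp).2.2
    dsimp only at this
    omega

open Classical in
/-- The generating polynomial of the pairs with one-block join for which `S` is the set of points
moved by `α⁻¹ β`. -/
noncomputable def supportSum (n : ℕ) (S : Finset (Fin n)) : WeightRing :=
  ∑ p : NCPartition n × NCPartition n with
    p.1 ⊔ p.2 = ⊤ ∧ (p.1.toPerm⁻¹ * p.2.toPerm).support = S, weight p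

/-- The generating polynomial of the pairs with one-block join for which `α⁻¹ β` has no fixed
point. -/
noncomputable def reducedSum (n : ℕ) : WeightRing := supportSum n Finset.univ

theorem ncDist_self (α : NCPartition n) : ncDist α α = 0 := by
  rw [ncDist, inv_mul_cancel, permLength_one]

theorem supportSum_empty (n : ℕ) : supportSum n ∅ = 1 := by
  classical
  have h : (Finset.univ.filter fun p : NCPartition n × NCPartition n =>
      p.1 ⊔ p.2 = ⊤ ∧ (p.1.toPerm⁻¹ * p.2.toPerm).support = ∅) = {(⊤, ⊤)} := by
    ext ⟨α, β⟩
    simp only [Finset.mem_filter, Finset.mem_univ, true_and, Equiv.Perm.support_eq_empty_iff,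
      Finset.mem_singleton, Prod.mk.injEq]
    constructor
    · rintro ⟨h1, h2⟩
      obtain rfl : α = β := toPerm_injective (inv_mul_eq_one.1 h2)
      rw [sup_idem] at h1
      exact ⟨h1, h1⟩
    · rintro ⟨rfl, rfl⟩
      exact ⟨sup_idem _, inv_mul_cancel _⟩
  rw [supportSum, h, Finset.sum_singleton, weight]
  dsimp only
  rw [sup_idem, ncDist_self]
  rfl

/-- A point that is fixed by `α⁻¹ β` can be contracted to its cyclic successor. -/
theorem supportSum_succAbove {i : Fin (n + 2)} {S : Finset (Fin (n + 2))} (hi : i ∉ S) :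
    supportSum (n + 2) S = supportSum (n + 1) (Finset.univ.filter fun u => i.succAbove u ∈ S) := by
  classical
  have hmono := i.strictMono_succAbove
  have hrel : ∀ p : NCPartition (n + 2) × NCPartition (n + 2), (p.1 ⊔ p.2 = ⊤ ∧
      (p.1.toPerm⁻¹ * p.2.toPerm).support = S) →
      p.1.next i = p.2.next i ∧ p.1.rel i (i + 1) ∧ p.2.rel i (i + 1) := by
    rintro p ⟨h1, h2⟩
    have h3 : p.1.next i = p.2.next i := by
      rw [← inv_mul_toPerm_apply_eq_self_iff, ← Equiv.Perm.notMem_support, h2]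
      exact hi
    have h4 := next_eq_add_one_of_sup_eq_top h1 h3
    refine ⟨h3, ?_, ?_⟩
    · rw [← h4]; exact (p.1.next_spec i).1
    · rw [← h4, h3]; exact (p.2.next_spec i).1
  have hins : ∀ q : NCPartition (n + 1) × NCPartition (n + 1),
      (insertPoint i q.1).next i = (insertPoint i q.2).next i := fun q => by
    rw [next_eq_add_one (insertPoint_rel i q.1), next_eq_add_one (insertPoint_rel i q.2)]
  have hiff : ∀ q : NCPartition (n + 1) × NCPartition (n + 1),
      (insertPoint i q.1 ⊔ insertPoint i q.2 = ⊤ ∧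
        ((insertPoint i q.1).toPerm⁻¹ * (insertPoint i q.2).toPerm).support = S) ↔
      (q.1 ⊔ q.2 = ⊤ ∧ (q.1.toPerm⁻¹ * q.2.toPerm).support =
        Finset.univ.filter fun u => i.succAbove u ∈ S) := by
    intro q
    rw [insertPoint_sup_eq_top_iff]
    refine and_congr_right fun _ => ?_
    have hsupp : ∀ u, i.succAbove u ∈
        ((insertPoint i q.1).toPerm⁻¹ * (insertPoint i q.2).toPerm).support ↔
        u ∈ (q.1.toPerm⁻¹ * q.2.toPerm).support := by
      intro u
      rw [Equiv.Perm.mem_support, Equiv.Perm.mem_support, inv_mul_toPerm_succAbove (hins q),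
        comap_insertPoint, comap_insertPoint, i.succAbove_right_injective.ne_iff]
    constructor
    · intro h
      ext u
      rw [← hsupp, h, Finset.mem_filter]
      simp
    · intro h
      ext x
      by_cases hx : x = i
      · subst hx
        refine iff_of_false ?_ hi
        rw [Equiv.Perm.notMem_support, inv_mul_toPerm_apply_eq_self_iff]
        exact hins q
      · obtain ⟨u, rfl⟩ := Fin.exists_succAbove_eq hx
        rw [hsupp, h, Finset.mem_filter]
        simp
  refine Finset.sum_nbij'
    (fun p => (p.1.comap i.succAbove hmono, p.2.comap i.succAbove hmono))
    (fun q => (insertPoint i q.1, insertPoint i q.2)) ?_ ?_ ?_ ?_ ?_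
  · intro p hp
    rw [Finset.mem_filter] at hp ⊢
    obtain ⟨-, h1, h2⟩ := hrel p hp.2
    refine ⟨Finset.mem_univ _, (hiff _).1 ?_⟩
    dsimp only
    rw [insertPoint_comap h1, insertPoint_comap h2]
    exact hp.2
  · intro q hq
    rw [Finset.mem_filter] at hq ⊢
    exact ⟨Finset.mem_univ _, (hiff q).2 hq.2⟩
  · intro p hp
    obtain ⟨-, h1, h2⟩ := hrel p (Finset.mem_filter.1 hp).2
    exact Prod.ext (insertPoint_comap h1) (insertPoint_comap h2)
  · intro q _
    exact Prod.ext (comap_insertPoint i q.1) (comap_insertPoint i q.2)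
  · intro p hp
    have hp' := (Finset.mem_filter.1 hp).2
    obtain ⟨h0, h1, h2⟩ := hrel p hp'
    have htop : (p.1.comap i.succAbove hmono) ⊔ (p.2.comap i.succAbove hmono) = ⊤ := by
      rw [← insertPoint_sup_eq_top_iff i, insertPoint_comap h1, insertPoint_comap h2]
      exact hp'.1
    have e1 := next_eq_add_one h1
    have e2 := next_eq_add_one h2
    have e3 : (⊤ : NCPartition (n + 2)).next i = i + 1 := next_eq_add_one (top_rel _ _)
    simp only [weight]
    rw [htop, hp'.1, ncDist_comap_succAbove h0, ← comap_top i.succAbove hmono,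
      ncDist_comap_succAbove (e1.trans e3.symm), ncDist_comap_succAbove (e2.trans e3.symm)]

theorem supportSum_eq_reducedSum (n : ℕ) (S : Finset (Fin n)) :
    supportSum n S = reducedSum S.card := by
  classical
  have huniv : ∀ n, supportSum n Finset.univ = reducedSum (Finset.univ : Finset (Fin n)).card := by
    intro n; rw [Finset.card_fin, reducedSum]
  have hempty : ∀ n, supportSum n ∅ = reducedSum (∅ : Finset (Fin n)).card := by
    intro n
    rw [supportSum_empty, Finset.card_empty, reducedSum,
      show (Finset.univ : Finset (Fin 0)) = ∅ from rfl, supportSum_empty]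
  induction n with
  | zero => rw [show S = ∅ from Subsingleton.elim _ _]; exact hempty 0
  | succ n ih =>
    by_cases hS : S = Finset.univ
    · rw [hS]; exact huniv _
    obtain ⟨i, hi⟩ : ∃ i, i ∉ S := by
      by_contra! h
      exact hS (Finset.eq_univ_iff_forall.2 h)
    cases n with
    | zero =>
      rw [show S = ∅ from Finset.eq_empty_of_forall_notMem fun x =>
        (Fin.ext (by omega) : i = x) ▸ hi]
      exact hempty _
    | succ n =>
      rw [supportSum_succAbove hi, ih]
      congr 1
      rw [← Finset.card_map i.succAboveEmb]
      congr 1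
      ext x
      simp only [Finset.mem_map, Finset.mem_filter, Finset.mem_univ, true_and]
      constructor
      · rintro ⟨u, hu, rfl⟩; exact hu
      · intro hx
        obtain ⟨u, rfl⟩ := Fin.exists_succAbove_eq (show x ≠ i from fun h => hi (h ▸ hx))
        exact ⟨u, hx, rfl⟩

theorem irreducibleSum_eq (n : ℕ) :
    irreducibleSum n = ∑ k ∈ Finset.range (n + 1), n.choose k • reducedSum k := by
  classical
  have h := Finset.sum_powerset_apply_card (x := (Finset.univ : Finset (Fin n))) reducedSum
  rw [Finset.card_fin] at h
  rw [← h, Finset.powerset_univ]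
  simp_rw [← supportSum_eq_reducedSum, supportSum]
  rw [irreducibleSum, ← Finset.sum_fiberwise (g := fun p => (p.1.toPerm⁻¹ * p.2.toPerm).support)]
  simp_rw [Finset.filter_filter]

theorem reducedSum_zero : reducedSum 0 = 1 := by
  rw [reducedSum, show (Finset.univ : Finset (Fin 0)) = ∅ from rfl, supportSum_empty]

/-- A permutation of length `r` of `k ≥ 1` points has `k - r ≥ 1` orbits, and at least two points
per orbit if it has no fixed point. -/
theorem lt_and_le_of_coeff_reducedSum_ne_zero {k r a b : ℕ} (hk : 1 ≤ k)
    (h : (reducedSum k).coeff (r, a, b) ≠ 0) : r + 1 ≤ k ∧ k ≤ 2 * r := by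
  classical
  rw [reducedSum, supportSum, AddMonoidAlgebra.coeff_sum, Finsupp.finsetSum_apply] at h
  obtain ⟨p, hp, hne⟩ := Finset.exists_ne_zero_of_sum_ne_zero h
  rw [coeff_weight, ite_ne_right_iff] at hne
  obtain ⟨⟨hr, -, -⟩, -⟩ := hne
  have hp' := (Finset.mem_filter.1 hp).2.2
  rw [← hr, ncDist]
  refine ⟨permLength_lt hk _, card_le_two_mul_permLength _ fun i => ?_⟩
  rw [← Equiv.Perm.mem_support, hp']
  exact Finset.mem_univ i

end NCPartition

/-! ### Lagrange inversion and the counting formula -/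

section Lagrange

open PowerSeries

/-- For the generating series `A_t` of the rows of `A` the hypotheses say that
`A_t = c_t * X ^ t + M * A_{t + 1}` and `A_0 = M`; hence `M = ∑ c_i * X ^ i * M ^ i`. -/
theorem coeff_pow_succ_of_peeling {R : Type*} [CommRing R] {M c : ℕ → R} {A : ℕ → ℕ → R}
    (hzero : ∀ n, A 0 n = M n) (hself : ∀ n, A n n = c n) (hlt : ∀ t n, n < t → A t n = 0)
    (hstep : ∀ t n, t < n → A t n =
      ∑ p ∈ Finset.HasAntidiagonal.antidiagonal n, M p.1 * A (t + 1) p.2) (n j : ℕ) :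
    coeff n (mk M ^ (j + 1)) =
      ∑ p ∈ Finset.HasAntidiagonal.antidiagonal n, c p.1 * coeff p.2 (mk M ^ (p.1 + j)) := by
  have hrec : ∀ t, mk (A t) = C (c t) * X ^ t + mk M * mk (A (t + 1)) := by
    intro t
    ext n
    rw [map_add, coeff_C_mul, coeff_X_pow, coeff_mul]
    simp only [coeff_mk]
    rcases lt_trichotomy n t with h | rfl | h
    · rw [hlt t n h, if_neg h.ne, mul_zero, zero_add]
      refine (Finset.sum_eq_zero fun p hp => ?_).symm
      rw [Finset.HasAntidiagonal.mem_antidiagonal] at hp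
      rw [hlt _ _ (by omega), mul_zero]
    · rw [hself, if_pos rfl, mul_one, left_eq_add]
      refine Finset.sum_eq_zero fun p hp => ?_
      rw [Finset.HasAntidiagonal.mem_antidiagonal] at hp
      rw [hlt _ _ (by omega), mul_zero]
    · rw [if_neg h.ne', mul_zero, zero_add, hstep t n h]
  have hiter : ∀ N, mk M = ∑ i ∈ Finset.range N, C (c i) * X ^ i * mk M ^ i +
      mk M ^ N * mk (A N) := by
    intro N
    induction N with
    | zero => simp only [Finset.range_zero, Finset.sum_empty, pow_zero, one_mul, zero_add]
              ext n; simp [hzero]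
    | succ N ih =>
      rw [Finset.sum_range_succ]
      conv_lhs => rw [ih, hrec N]
      ring
  have hX : X ^ (n + 1) ∣ mk (A (n + 1)) := by
    rw [X_pow_dvd_iff]
    intro m hm
    rw [coeff_mk, hlt _ _ hm]
  obtain ⟨E, hE⟩ := hX
  have h := hiter (n + 1)
  rw [hE] at h
  have h' : mk M ^ (j + 1) = ∑ i ∈ Finset.range (n + 1), C (c i) * (X ^ i * mk M ^ (i + j)) +
      X ^ (n + 1) * (mk M ^ (n + 1) * E * mk M ^ j) := by
    have h'' := congrArg (· * mk M ^ j) h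
    rw [pow_succ', h'', add_mul, Finset.sum_mul]
    congr 1
    · refine Finset.sum_congr rfl fun i _ => ?_
      rw [pow_add]
      ring
    · ring
  rw [h', map_add, coeff_X_pow_mul', if_neg (by omega), add_zero, map_sum,
    Finset.Nat.sum_antidiagonal_eq_sum_range_succ
      (fun i l => c i * coeff l (mk M ^ (i + j)))]
  refine Finset.sum_congr rfl fun i hi => ?_
  rw [coeff_C_mul, coeff_X_pow_mul', if_pos (by have := Finset.mem_range.1 hi; omega)]

/-- Lagrange inversion: the hypothesis says that `M = c(X * M)`. -/
theorem add_mul_coeff_pow_of_functional_equation {R : Type*} [CommRing R] [Algebra ℚ R]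
    {M c : R⟦X⟧}
    (h : ∀ n j, coeff n (M ^ (j + 1)) = ∑ p ∈ Finset.HasAntidiagonal.antidiagonal n,
      coeff p.1 c * coeff p.2 (M ^ (p.1 + j))) (n j : ℕ) :
    ((n + j : ℕ) : R) * coeff n (M ^ j) = (j : R) * coeff n (c ^ (n + j)) := by
  induction n using Nat.strong_induction_on generalizing j with
  | _ n ihn =>
    induction j with
    | zero =>
      rcases Nat.eq_zero_or_pos n with rfl | hn
      · simp
      · simp [coeff_one, hn.ne']
    | succ j ihj =>
      rcases Nat.eq_zero_or_pos (n + j) with h0 | hpos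
      · obtain ⟨rfl, rfl⟩ : n = 0 ∧ j = 0 := by omega
        have := h 0 0
        simp only [Finset.Nat.antidiagonal_zero, Finset.sum_singleton] at this
        simpa using this
      -- the term `i = 0` uses the induction on `j`, the others the induction on `n`
      have h1 : ((n + j : ℕ) : R) * coeff n (M ^ (j + 1)) =
          coeff n ((X * d⁄dX R c + (j : R⟦X⟧) * c) * c ^ (n + j)) := by
        rw [h, Finset.mul_sum, coeff_mul]
        refine Finset.sum_congr rfl fun p hp => ?_
        obtain ⟨i, l⟩ := p
        rw [Finset.HasAntidiagonal.mem_antidiagonal] at hp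
        dsimp only at hp ⊢
        have hl : ((l + (i + j) : ℕ) : R) * coeff l (M ^ (i + j)) =
            ((i + j : ℕ) : R) * coeff l (c ^ (l + (i + j))) := by
          rcases Nat.eq_zero_or_pos i with rfl | hi
          · have : l = n := by omega
            subst this
            rw [zero_add]; exact ihj
          · exact ihn l (by omega) (i + j)
        rw [show l + (i + j) = n + j by omega] at hl
        rw [mul_left_comm, hl]
        have hco : coeff i (X * d⁄dX R c + (j : R⟦X⟧) * c) = ((i + j : ℕ) : R) * coeff i c := by
          rw [map_add, show (j : R⟦X⟧) = C (j : R) by simp, coeff_C_mul]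
          cases i with
          | zero => simp
          | succ i => rw [coeff_succ_X_mul, coeff_derivative]; push_cast; ring
        rw [hco]; ring
      have h2 : ((n + j + 1 : ℕ) : R) * coeff n ((X * d⁄dX R c + (j : R⟦X⟧) * c) * c ^ (n + j)) =
          ((n + j : ℕ) : R) * (((j + 1 : ℕ) : R) * coeff n (c ^ (n + j + 1))) := by
        have h3 : ((n + j + 1 : ℕ) : R⟦X⟧) *
            ((X * d⁄dX R c + (j : R⟦X⟧) * c) * c ^ (n + j)) =
            X * d⁄dX R (c ^ (n + j + 1)) + ((n + j + 1 : ℕ) * j : R⟦X⟧) * c ^ (n + j + 1) := by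
          rw [derivative_pow]
          simp only [Nat.add_sub_cancel]
          ring
        have h4 : coeff n (X * d⁄dX R (c ^ (n + j + 1))) = (n : R) * coeff n (c ^ (n + j + 1)) := by
          cases n with
          | zero => simp
          | succ n => rw [coeff_succ_X_mul, coeff_derivative]; push_cast; ring
        have h5 := congrArg (coeff n) h3
        rw [map_add, h4, show ((n + j + 1 : ℕ) : R⟦X⟧) = C ((n + j + 1 : ℕ) : R) by simp,
          show (j : R⟦X⟧) = C (j : R) by simp, ← map_mul, coeff_C_mul, coeff_C_mul] at h5
        rw [show (j : R⟦X⟧) = C (j : R) by simp, h5]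
        push_cast
        ring
      have hu : IsUnit ((n + j : ℕ) : R) := by
        rw [← map_natCast (algebraMap ℚ R)]
        exact (IsUnit.mk0 _ (by exact_mod_cast hpos.ne')).map _
      rw [← h1, mul_left_comm] at h2
      exact hu.mul_left_cancel h2

theorem coeff_mul_subst {R : Type*} [CommRing R] (u f : R⟦X⟧) {w : R⟦X⟧}
    (hw : constantCoeff w = 0) (n : ℕ) :
    coeff n (u * f.subst w) = ∑ k ∈ Finset.range (n + 1), coeff k f * coeff n (u * w ^ k) := by
  have hs : HasSubst w := HasSubst.of_constantCoeff_zero' hw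
  obtain ⟨g, hg⟩ : X ^ (n + 1) ∣ f - (trunc (n + 1) f : R⟦X⟧) := by
    rw [X_pow_dvd_iff]
    intro m hm
    rw [map_sub, Polynomial.coeff_coe, coeff_trunc, if_pos hm, sub_self]
  obtain ⟨v, rfl⟩ := X_dvd_iff.2 hw
  have hf : f = (trunc (n + 1) f : R⟦X⟧) + X ^ (n + 1) * g := by rw [← hg]; ring
  have h1 : f.subst (X * v : R⟦X⟧) =
      ∑ k ∈ Finset.range (n + 1), C (coeff k f) * (X * v) ^ k +
        X ^ (n + 1) * (v ^ (n + 1) * g.subst (X * v : R⟦X⟧)) := by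
    conv_lhs => rw [hf]
    rw [subst_add hs, subst_mul hs, subst_pow hs, subst_X hs, subst_coe hs,
      Polynomial.aeval_eq_sum_range' (n := n + 1) (natDegree_trunc_lt f n)]
    congr 1
    · refine Finset.sum_congr rfl fun k hk => ?_
      rw [coeff_trunc, if_pos (Finset.mem_range.1 hk), smul_eq_C_mul]
    · rw [mul_pow]; ring
  rw [h1, mul_add, map_add, mul_left_comm, coeff_X_pow_mul', if_neg (by omega), add_zero,
    Finset.mul_sum, map_sum]
  refine Finset.sum_congr rfl fun k _ => ?_
  rw [mul_left_comm, coeff_C_mul]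

theorem invOneSubPow_eq_pow {R : Type*} [CommRing R] (d : ℕ) :
    invOneSubPow R d = invOneSubPow R 1 ^ d := by
  induction d with
  | zero => rw [invOneSubPow_zero, pow_zero]
  | succ d ih => rw [invOneSubPow_add, ih, ← pow_succ]

theorem coeff_X_pow_mul_invOneSubPow {R : Type*} [CommRing R] (k d n : ℕ) :
    coeff n (X ^ k * (invOneSubPow R (d + 1) : R⟦X⟧)) =
      if k ≤ n then ((d + (n - k)).choose d : R) else 0 := by
  rw [coeff_X_pow_mul', invOneSubPow_val_succ_eq_mk_add_choose, coeff_mk]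

/-- The binomial transform turns `f` into `(1 - X)⁻¹ * f(X / (1 - X))`. -/
theorem mk_binomial_transform {R : Type*} [CommRing R] (f : R⟦X⟧) :
    (mk fun n => ∑ k ∈ Finset.range (n + 1), n.choose k • coeff k f) =
      (invOneSubPow R 1 : R⟦X⟧) * f.subst (X * (invOneSubPow R 1 : R⟦X⟧)) := by
  ext n
  rw [coeff_mk, coeff_mul_subst _ _ (by simp)]
  refine Finset.sum_congr rfl fun k hk => ?_
  have hk' := Finset.mem_range.1 hk
  have : (invOneSubPow R 1 : R⟦X⟧) * (X * (invOneSubPow R 1 : R⟦X⟧)) ^ k =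
      X ^ k * (invOneSubPow R (k + 1) : R⟦X⟧) := by
    rw [invOneSubPow_eq_pow (k + 1), Units.val_pow_eq_pow_val]
    ring
  rw [this, coeff_X_pow_mul_invOneSubPow, if_pos (by omega), Nat.add_sub_cancel' (by omega),
    nsmul_eq_mul, mul_comm]

theorem coeff_binomial_transform_pow {R : Type*} [CommRing R] (f : R⟦X⟧) (n N : ℕ) :
    coeff n ((mk fun n => ∑ k ∈ Finset.range (n + 1), n.choose k • coeff k f) ^ (N + 1)) =
      ∑ k ∈ Finset.range (n + 1), ((n + N).choose (N + k) : R) * coeff k (f ^ (N + 1)) := by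
  have hs : HasSubst (X * (invOneSubPow R 1 : R⟦X⟧)) := HasSubst.of_constantCoeff_zero' (by simp)
  rw [mk_binomial_transform, mul_pow, ← subst_pow hs, coeff_mul_subst _ _ (by simp)]
  refine Finset.sum_congr rfl fun k hk => ?_
  have hk' := Finset.mem_range.1 hk
  have : (invOneSubPow R 1 : R⟦X⟧) ^ (N + 1) * (X * (invOneSubPow R 1 : R⟦X⟧)) ^ k =
      X ^ k * (invOneSubPow R (N + k + 1) : R⟦X⟧) := by
    rw [invOneSubPow_eq_pow (N + k + 1), Units.val_pow_eq_pow_val]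
    ring
  rw [this, coeff_X_pow_mul_invOneSubPow, if_pos (by omega), mul_comm,
    show N + k + (n - k) = n + N by omega]

end Lagrange

namespace NCPartition

open PowerSeries

/-- Lagrange inversion for the decomposition of a pair along the blocks of its join. -/
theorem succ_mul_pairSum (n : ℕ) :
    ((n + 1 : ℕ) : WeightRing) * pairSum n = ∑ k ∈ Finset.range (n + 1),
      ((2 * n).choose (n + k) : WeightRing) * coeff k (PowerSeries.mk reducedSum ^ (n + 1)) := by
  have h := add_mul_coeff_pow_of_functional_equation (M := PowerSeries.mk pairSum)
    (c := PowerSeries.mk irreducibleSum)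
    (fun n j => by
      simp_rw [coeff_mk _ irreducibleSum]
      exact coeff_pow_succ_of_peeling tailSum_zero tailSum_self (fun t n => tailSum_of_lt)
        (fun t n => tailSum_eq_sum_antidiagonal) n j) n 1
  have hb := coeff_binomial_transform_pow (PowerSeries.mk reducedSum) n n
  simp_rw [coeff_mk _ reducedSum, ← irreducibleSum_eq] at hb
  rw [pow_one, coeff_mk, Nat.cast_one, one_mul, hb] at h
  rw [h, two_mul]

/-- The generating series of the reduced pairs with at least one point. -/
noncomputable def reducedSeries : WeightRing⟦X⟧ :=
  PowerSeries.mk fun k => if k = 0 then 0 else reducedSum k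

theorem mk_reducedSum : PowerSeries.mk reducedSum = reducedSeries + 1 := by
  ext k
  rw [map_add, reducedSeries, coeff_mk, coeff_mk, coeff_one]
  split_ifs with hk
  · rw [hk, reducedSum_zero, zero_add]
  · rw [add_zero]

theorem exists_coeff_ne_zero_of_coeff_mul_ne_zero {f g : WeightRing} {r a b : ℕ}
    (h : (f * g).coeff (r, a, b) ≠ 0) : ∃ r₁ a₁ b₁ r₂ a₂ b₂ : ℕ, r₁ + r₂ = r ∧
      f.coeff (r₁, a₁, b₁) ≠ 0 ∧ g.coeff (r₂, a₂, b₂) ≠ 0 := by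
  classical
  have hmem := AddMonoidAlgebra.support_coeff_mul_subset f g (Finsupp.mem_support_iff.2 h)
  obtain ⟨⟨r₁, a₁, b₁⟩, h₁, ⟨r₂, a₂, b₂⟩, h₂, he⟩ := Finset.mem_add.1 hmem
  exact ⟨r₁, a₁, b₁, r₂, a₂, b₂, congrArg Prod.fst he, Finsupp.mem_support_iff.1 h₁,
    Finsupp.mem_support_iff.1 h₂⟩

theorem exists_coeff_ne_zero_of_sum {ι : Type*} {s : Finset ι} {f : ι → WeightRing}
    {d : ℕ × ℕ × ℕ} (h : (∑ i ∈ s, f i).coeff d ≠ 0) : ∃ i ∈ s, (f i).coeff d ≠ 0 := by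
  rw [AddMonoidAlgebra.coeff_sum, Finsupp.finsetSum_apply] at h
  exact Finset.exists_ne_zero_of_sum_ne_zero h

theorem add_le_and_le_of_coeff_reducedSeries_pow_ne_zero {m k r a b : ℕ}
    (h : (coeff k (reducedSeries ^ m)).coeff (r, a, b) ≠ 0) : r + m ≤ k ∧ k ≤ 2 * r := by
  induction m generalizing k r a b with
  | zero =>
    rw [pow_zero, coeff_one] at h
    split_ifs at h with hk
    · rw [AddMonoidAlgebra.one_def, AddMonoidAlgebra.coeff_single, Finsupp.single_apply,
        ite_ne_right_iff] at h
      have : 0 = r := congrArg Prod.fst h.1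
      omega
    · exact (h rfl).elim
  | succ m ih =>
    rw [pow_succ, coeff_mul] at h
    obtain ⟨⟨k₁, k₂⟩, hk, h⟩ := exists_coeff_ne_zero_of_sum h
    rw [Finset.HasAntidiagonal.mem_antidiagonal] at hk
    obtain ⟨r₁, a₁, b₁, r₂, a₂, b₂, hr, h₁, h₂⟩ := exists_coeff_ne_zero_of_coeff_mul_ne_zero h
    dsimp only at hk h₁ h₂
    have e₁ := ih h₁
    rw [reducedSeries, coeff_mk] at h₂
    split_ifs at h₂ with hk₂
    · exact (h₂ rfl).elim
    have e₂ := lt_and_le_of_coeff_reducedSum_ne_zero (Nat.pos_of_ne_zero hk₂) h₂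
    omega

theorem succ_mul_ncard_meandricPairs (n r a b : ℕ) :
    ((n + 1 : ℕ) : ℚ) * ((meandricPairs n r a b).ncard : ℚ) =
      ∑ k ∈ Finset.range (n + 1), ∑ m ∈ Finset.range (n + 2),
        ((2 * n).choose (n + k) : ℚ) * ((n + 1).choose m : ℚ) *
          (coeff k (reducedSeries ^ m)).coeff (r, a, b) := by
  have hcast : ∀ (N : ℕ) (f : WeightRing) (d : ℕ × ℕ × ℕ),
      ((N : WeightRing) * f).coeff d = (N : ℚ) * f.coeff d := by
    intro N f d
    rw [← nsmul_eq_mul, AddMonoidAlgebra.coeff_smul, Finsupp.smul_apply, nsmul_eq_mul]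
  have h := congrArg (fun f : WeightRing => f.coeff (r, a, b)) (succ_mul_pairSum n)
  rw [hcast, coeff_pairSum, AddMonoidAlgebra.coeff_sum, Finsupp.finsetSum_apply] at h
  rw [h]
  refine Finset.sum_congr rfl fun k _ => ?_
  rw [hcast, mk_reducedSum, add_pow, map_sum, AddMonoidAlgebra.coeff_sum, Finsupp.finsetSum_apply,
    Finset.mul_sum]
  refine Finset.sum_congr rfl fun m _ => ?_
  rw [one_pow, mul_one, mul_comm (reducedSeries ^ m),
    show (((n + 1).choose m : ℕ) : WeightRing⟦X⟧) = C (((n + 1).choose m : ℕ) : WeightRing) by simp,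
    coeff_C_mul, hcast, mul_assoc]

/-- The number of pairs in `meandricPairs n r a b` is, for `r ≥ 1`, a combination of the numbers
`(n choose j) * (2 * n choose n + k)` with `j < r < k ≤ 2 * r`. -/
theorem ncard_meandricPairs_eq_sum {r : ℕ} (hr : 1 ≤ r) (n a b : ℕ) :
    ((meandricPairs n r a b).ncard : ℚ) =
      ∑ k ∈ Finset.Icc (r + 1) (2 * r), ∑ j ∈ Finset.range r,
        (coeff k (reducedSeries ^ (j + 1))).coeff (r, a, b) / (j + 1) *
          ((n.choose j : ℚ) * ((2 * n).choose (n + k) : ℚ)) := by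
  have hn : ((n + 1 : ℕ) : ℚ) ≠ 0 := by positivity
  refine mul_left_cancel₀ hn ?_
  rw [succ_mul_ncard_meandricPairs]
  set q : ℕ → ℕ → ℚ := fun m k => (coeff k (reducedSeries ^ m)).coeff (r, a, b) with hq
  have hsupp : ∀ m k, q m k ≠ 0 → r + m ≤ k ∧ k ≤ 2 * r := fun m k h =>
    add_le_and_le_of_coeff_reducedSeries_pow_ne_zero h
  have hq0 : ∀ k, q 0 k = 0 := by
    intro k
    by_contra h
    have := hsupp 0 k h
    simp only [hq, pow_zero, coeff_one] at h
    rw [if_neg (by omega)] at h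
    exact h rfl
  have e1 : ∀ k, ∑ m ∈ Finset.range (n + 2),
      ((2 * n).choose (n + k) : ℚ) * ((n + 1).choose m : ℚ) * q m k =
      ((n + 1 : ℕ) : ℚ) * ∑ j ∈ Finset.range r,
        q (j + 1) k / (j + 1) * ((n.choose j : ℚ) * ((2 * n).choose (n + k) : ℚ)) := by
    intro k
    rw [Finset.sum_range_succ', hq0, mul_zero, add_zero, Finset.mul_sum]
    have hterm : ∀ j, ((2 * n).choose (n + k) : ℚ) * ((n + 1).choose (j + 1) : ℚ) * q (j + 1) k =
        ((n + 1 : ℕ) : ℚ) *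
          (q (j + 1) k / (j + 1) * ((n.choose j : ℚ) * ((2 * n).choose (n + k) : ℚ))) := by
      intro j
      have := Nat.add_one_mul_choose_eq n j
      have hc : ((n + 1 : ℕ) : ℚ) * (n.choose j : ℚ) = ((n + 1).choose (j + 1) : ℚ) * (j + 1) := by
        exact_mod_cast this
      have hj : (j + 1 : ℚ) ≠ 0 := by positivity
      field_simp
      linear_combination (-((2 * n).choose (n + k) : ℚ) * q (j + 1) k) * hc
    rw [Finset.sum_congr rfl fun j _ => hterm j]
    rcases le_total (n + 1) r with h | h
    · refine Finset.sum_subset (Finset.range_subset_range.2 h) fun j _ hj => ?_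
      rw [← hterm, Nat.choose_eq_zero_of_lt (by rw [Finset.mem_range] at hj; omega : n + 1 < j + 1)]
      simp
    · refine (Finset.sum_subset (Finset.range_subset_range.2 h) fun j _ hj => ?_).symm
      have : q (j + 1) k = 0 := by
        by_contra hne
        have := hsupp _ _ hne
        rw [Finset.mem_range] at hj
        omega
      rw [this]; simp
  rw [Finset.sum_congr rfl fun k _ => e1 k, ← Finset.mul_sum]
  congr 1
  -- both sums are the sum over all `k ≤ max n (2 * r)`
  have hsub : ∀ s : Finset ℕ, (∀ k, k ∉ s → n < k ∨ k < r + 1 ∨ 2 * r < k) → ∀ k, k ∉ s →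
      ∑ j ∈ Finset.range r,
        q (j + 1) k / (j + 1) * ((n.choose j : ℚ) * ((2 * n).choose (n + k) : ℚ)) = 0 := by
    intro s hs k hk
    refine Finset.sum_eq_zero fun j _ => ?_
    by_cases hne : q (j + 1) k = 0
    · rw [hne]; simp
    have := hsupp _ _ hne
    rw [Nat.choose_eq_zero_of_lt (by have := hs k hk; omega : 2 * n < n + k)]
    simp
  rw [Finset.sum_subset (Finset.subset_union_left (s₂ := Finset.Icc (r + 1) (2 * r)))
      fun k _ hk => hsub _ (fun k hk => Or.inl (by rw [Finset.mem_range] at hk; omega)) k hk,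
    Finset.sum_subset (Finset.subset_union_right (s₁ := Finset.range (n + 1)))
      fun k _ hk => hsub (Finset.Icc (r + 1) (2 * r)) (fun k hk => Or.inr (by
        rw [Finset.mem_Icc] at hk; omega)) k hk]

theorem ncard_meandricPairs_zero (n a b : ℕ) :
    ((meandricPairs n 0 a b).ncard : ℚ) = if a = 0 ∧ b = 0 then (catalan n : ℚ) else 0 := by
  have hn : ((n + 1 : ℕ) : ℚ) ≠ 0 := by positivity
  refine mul_left_cancel₀ hn ?_
  rw [succ_mul_ncard_meandricPairs, Finset.sum_eq_single 0, Finset.sum_eq_single 0]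
  · have hcat : ((n + 1 : ℕ) : ℚ) * (catalan n : ℚ) = ((2 * n).choose n : ℚ) := by
      exact_mod_cast succ_mul_catalan_eq_centralBinom n
    rw [pow_zero, coeff_one, if_pos rfl, AddMonoidAlgebra.one_def, AddMonoidAlgebra.coeff_single,
      Finsupp.single_apply, mul_ite, mul_ite, mul_zero, mul_zero, hcat]
    simp only [add_zero, Nat.choose_zero_right, Nat.cast_one, mul_one]
    refine if_congr ?_ rfl rfl
    rw [Prod.ext_iff, Prod.ext_iff]
    simp [eq_comm]
  · intro m _ hm
    by_contra h
    have := add_le_and_le_of_coeff_reducedSeries_pow_ne_zero (right_ne_zero_of_mul h)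
    omega
  · intro h; simp at h
  · intro k _ hk
    refine Finset.sum_eq_zero fun m _ => ?_
    by_contra h
    have := add_le_and_le_of_coeff_reducedSeries_pow_ne_zero (right_ne_zero_of_mul h)
    omega
  · intro h; simp at h

end NCPartition

/-! ### The change of variable -/

section ChangeOfVariable

open PowerSeries

theorem changeVar_mul_one_add_X_sq : changeVar * (1 + X) ^ 2 = X := by
  rw [changeVar, mul_assoc, PowerSeries.inv_mul_cancel _ (by simp), mul_one]

theorem derivative_changeVar_mul : d⁄dX ℚ changeVar * (1 + X) ^ 3 = 1 - X := by
  have h := congrArg (d⁄dX ℚ) changeVar_mul_one_add_X_sq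
  rw [Derivation.leibniz, derivative_pow, map_add, derivative_one, derivative_X, smul_eq_mul,
    smul_eq_mul] at h
  simp only [Nat.cast_ofNat, Nat.add_one_sub_one, pow_one, zero_add, mul_one] at h
  linear_combination (1 + X) * h - 2 * changeVar_mul_one_add_X_sq

/-- The Euler operator `X * d/dX` becomes `W * (1 + W) / (1 - W) * d/dW` under the change of
variable. -/
theorem one_sub_X_mul_subst_X_mul_derivative (G : ℚ⟦X⟧) :
    (1 - X) * (X * d⁄dX ℚ G).subst changeVar =
      X * (1 + X) * d⁄dX ℚ (G.subst changeVar) := by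
  rw [derivative_subst changeVar_hasSubst, subst_mul changeVar_hasSubst,
    subst_X changeVar_hasSubst]
  linear_combination (-(changeVar * (d⁄dX ℚ G).subst changeVar)) * derivative_changeVar_mul +
    (1 + X) * d⁄dX ℚ changeVar * (d⁄dX ℚ G).subst changeVar * changeVar_mul_one_add_X_sq

/-- The series `∑ (2 * n choose n + k) * X ^ n`. -/
noncomputable def centralSeries (k : ℕ) : ℚ⟦X⟧ :=
  PowerSeries.mk fun n => ((2 * n).choose (n + k) : ℚ)

theorem centralSeries_zero :
    centralSeries 0 = 1 + X * (2 * centralSeries 0 + 2 * centralSeries 1) := by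
  ext n
  cases n with
  | zero => simp [centralSeries]
  | succ n =>
    rw [map_add, coeff_succ_X_mul, map_add, show (2 : ℚ⟦X⟧) = C (2 : ℚ) from (map_ofNat C 2).symm,
      coeff_C_mul, coeff_C_mul, coeff_one, if_neg (Nat.succ_ne_zero n), zero_add]
    simp only [centralSeries, coeff_mk]
    have h1 : (2 * (n + 1)).choose (n + 1 + 0) = 2 * (2 * n).choose (n + 0) +
        2 * (2 * n).choose (n + 1) := by
      have h2 := Nat.choose_symm_half n
      rw [show 2 * (n + 1) = 2 * n + 1 + 1 by ring, add_zero, add_zero, Nat.choose_succ_succ', ← h2,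
        Nat.choose_succ_succ']
      ring
    exact_mod_cast h1

theorem centralSeries_succ (k : ℕ) : centralSeries (k + 1) =
    X * (centralSeries k + 2 * centralSeries (k + 1) + centralSeries (k + 2)) := by
  ext n
  cases n with
  | zero => simp [centralSeries]
  | succ n =>
    rw [coeff_succ_X_mul, map_add, map_add, show (2 : ℚ⟦X⟧) = C (2 : ℚ) from (map_ofNat C 2).symm,
      coeff_C_mul]
    simp only [centralSeries, coeff_mk]
    have h1 : (2 * (n + 1)).choose (n + 1 + (k + 1)) = (2 * n).choose (n + k) +
        2 * (2 * n).choose (n + (k + 1)) + (2 * n).choose (n + (k + 2)) := by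
      rw [show 2 * (n + 1) = 2 * n + 1 + 1 by ring, show n + 1 + (k + 1) = n + k + 1 + 1 by ring,
        Nat.choose_succ_succ', Nat.choose_succ_succ', Nat.choose_succ_succ' (2 * n) (n + k + 1)]
      simp only [← add_assoc]
      ring
    exact_mod_cast h1

theorem subst_two_changeVar : (2 : ℚ⟦X⟧).subst changeVar = (2 : ℚ⟦X⟧) := by
  rw [← coe_substAlgHom changeVar_hasSubst]
  exact map_ofNat _ 2

theorem subst_one_changeVar : (1 : ℚ⟦X⟧).subst changeVar = (1 : ℚ⟦X⟧) := by
  rw [← coe_substAlgHom changeVar_hasSubst]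
  exact map_one _

/-- The Pascal recurrence in the variable `W` has `W ^ k * (1 + W) / (1 - W)` as its solution. -/
theorem subst_centralSeries (k : ℕ) :
    (centralSeries k).subst changeVar * (1 - X) = X ^ k * (1 + X) := by
  set E : ℕ → ℚ⟦X⟧ := fun k => (centralSeries k).subst changeVar with hE
  have hs := changeVar_hasSubst
  have hφ := changeVar_mul_one_add_X_sq
  have e0 : E 0 = 1 + changeVar * (2 * E 0 + 2 * E 1) := by
    have h := congrArg (fun f : ℚ⟦X⟧ => f.subst changeVar) centralSeries_zero
    simpa only [subst_add hs, subst_mul hs, subst_X hs, subst_two_changeVar,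
      subst_one_changeVar] using h
  have e1 : ∀ k, E (k + 1) = changeVar * (E k + 2 * E (k + 1) + E (k + 2)) := by
    intro k
    have h := congrArg (fun f : ℚ⟦X⟧ => f.subst changeVar) (centralSeries_succ k)
    simpa only [subst_add hs, subst_mul hs, subst_X hs, subst_two_changeVar] using h
  -- the defects satisfy a homogeneous recurrence whose only solution is zero
  obtain ⟨D, hD⟩ : ∃ D : ℕ → ℚ⟦X⟧, ∀ k, D k = E k * (1 - X) - X ^ k * (1 + X) :=
    ⟨_, fun _ => rfl⟩
  have d0 : D 0 * (1 + X ^ 2) = X * (2 * D 1) := by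
    rw [hD, hD]
    linear_combination (1 - X) * (1 + X) ^ 2 * e0 + (1 - X) * (2 * E 0 + 2 * E 1) * hφ
  have d1 : ∀ k, D (k + 1) * (1 + X ^ 2) = X * (D k + D (k + 2)) := by
    intro k
    rw [hD, hD, hD]
    linear_combination (1 - X) * (1 + X) ^ 2 * e1 k +
      (1 - X) * (E k + 2 * E (k + 1) + E (k + 2)) * hφ
  have hu : IsUnit (1 + X ^ 2 : ℚ⟦X⟧) := by
    rw [isUnit_iff_constantCoeff]; simp
  have hdvd : ∀ N k, X ^ N ∣ D k := by
    intro N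
    induction N with
    | zero => intro k; rw [pow_zero]; exact one_dvd _
    | succ N ih =>
      intro k
      rw [← hu.dvd_mul_right, pow_succ']
      cases k with
      | zero => rw [d0]; exact mul_dvd_mul_left _ (Dvd.dvd.mul_left (ih 1) _)
      | succ k => rw [d1]; exact mul_dvd_mul_left _ (dvd_add (ih k) (ih (k + 2)))
  have hz : D k = 0 := by
    ext n
    exact X_pow_dvd_iff.1 (hdvd (n + 1) k) n (Nat.lt_succ_self n)
  rw [hD] at hz
  exact sub_eq_zero.1 hz

/-- The series `∑ (n choose j) * (2 * n choose n + k) * X ^ n`. -/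
noncomputable def weightedCentralSeries (j k : ℕ) : ℚ⟦X⟧ :=
  PowerSeries.mk fun n => (n.choose j : ℚ) * ((2 * n).choose (n + k) : ℚ)

/-- `(j + 1) * (n choose j + 1) = (n - j) * (n choose j)`, written with the Euler operator. -/
theorem weightedCentralSeries_succ (j k : ℕ) :
    ((j : ℚ⟦X⟧) + 1) * weightedCentralSeries (j + 1) k =
      X * d⁄dX ℚ (weightedCentralSeries j k) - (j : ℚ⟦X⟧) * weightedCentralSeries j k := by
  ext n
  have hθ : coeff n (X * d⁄dX ℚ (weightedCentralSeries j k)) =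
      (n : ℚ) * coeff n (weightedCentralSeries j k) := by
    cases n with
    | zero => simp
    | succ n => rw [coeff_succ_X_mul, coeff_derivative]; push_cast; ring
  rw [map_sub, hθ, show (j : ℚ⟦X⟧) + 1 = C ((j : ℚ) + 1) by simp,
    show (j : ℚ⟦X⟧) = C (j : ℚ) by simp, coeff_C_mul, coeff_C_mul]
  simp only [weightedCentralSeries, coeff_mk]
  have h : ((j : ℚ) + 1) * (n.choose (j + 1) : ℚ) = ((n : ℚ) - j) * (n.choose j : ℚ) := by
    rcases le_or_gt j n with hjn | hjn
    · have := Nat.choose_succ_right_eq n j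
      rw [← Nat.cast_sub hjn]
      have h' : (n.choose (j + 1) : ℚ) * ((j : ℚ) + 1) = (n.choose j : ℚ) * ((n - j : ℕ) : ℚ) := by
        exact_mod_cast this
      linear_combination h'
    · rw [Nat.choose_eq_zero_of_lt hjn, Nat.choose_eq_zero_of_lt (by omega : n < j + 1)]
      simp
  linear_combination ((2 * n).choose (n + k) : ℚ) * h

theorem exists_polynomial_subst_weightedCentralSeries (j k : ℕ) : ∃ q : ℚ[X],
    q.natDegree ≤ 2 * j ∧ (weightedCentralSeries j k).subst changeVar * (1 - X) ^ (2 * j + 1) =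
      X ^ k * (1 + X) * (q : ℚ⟦X⟧) := by
  induction j with
  | zero =>
    refine ⟨1, by simp, ?_⟩
    have : weightedCentralSeries 0 k = centralSeries k := by
      ext n; simp [weightedCentralSeries, centralSeries]
    rw [this, mul_zero, zero_add, pow_one, subst_centralSeries, Polynomial.coe_one, mul_one]
  | succ j ih =>
    obtain ⟨q, hq, h⟩ := ih
    set F := (weightedCentralSeries j k).subst changeVar with hF
    set T := (X * d⁄dX ℚ (weightedCentralSeries j k)).subst changeVar with hT
    have hθ : (1 - X) * T = X * (1 + X) * d⁄dX ℚ F := one_sub_X_mul_subst_X_mul_derivative _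
    have hs := changeVar_hasSubst
    have hrec : C ((j : ℚ) + 1) * (weightedCentralSeries (j + 1) k).subst changeVar =
        T - C (j : ℚ) * F := by
      have h' := congrArg (fun f : ℚ⟦X⟧ => f.subst changeVar) (weightedCentralSeries_succ j k)
      have hcast : (j : ℚ⟦X⟧).subst changeVar = (j : ℚ⟦X⟧) := by
        rw [← coe_substAlgHom hs]; exact map_natCast _ j
      simp only [subst_sub hs, subst_mul hs, subst_add hs, hcast, subst_one_changeVar] at h'
      simpa only [map_add, map_natCast, map_one, hT, hF, subst_mul hs] using h'
    -- the derivative of the induction hypothesis, multiplied by `W * (1 - W)`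
    have hder : X * (1 - X) * (d⁄dX ℚ F * (1 - X) ^ (2 * j + 1)) =
        X ^ k * ((2 * (j : ℚ⟦X⟧) + 1) * X * (1 + X) * (q : ℚ⟦X⟧) +
          (1 - X) * ((k : ℚ⟦X⟧) * (1 + X) * (q : ℚ⟦X⟧) + X * (q : ℚ⟦X⟧) +
            X * (1 + X) * ((Polynomial.derivative q : ℚ[X]) : ℚ⟦X⟧))) := by
      have h1 := congrArg (d⁄dX ℚ) h
      simp only [Derivation.leibniz, derivative_pow, map_add, map_sub, derivative_one,
        derivative_X, smul_eq_mul, derivative_coe, zero_sub, zero_add, Nat.add_sub_cancel] at h1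
      have hk : X * ((k : ℚ⟦X⟧) * X ^ (k - 1)) = (k : ℚ⟦X⟧) * X ^ k := by
        cases k with
        | zero => simp
        | succ k => rw [Nat.add_sub_cancel]; ring
      push_cast at h1
      linear_combination (X * (1 - X)) * h1 + (2 * (j : ℚ⟦X⟧) + 1) * X * h +
        (1 - X) * (1 + X) * (q : ℚ⟦X⟧) * hk
    let p : ℚ[X] := (2 * (j : ℚ[X]) + 1) * Polynomial.X * (1 + Polynomial.X) * q +
      (1 - Polynomial.X) * ((k : ℚ[X]) * (1 + Polynomial.X) * q + Polynomial.X * q +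
        Polynomial.X * (1 + Polynomial.X) * Polynomial.derivative q) -
      (j : ℚ[X]) * (1 - Polynomial.X) ^ 2 * q
    have hp : (p : ℚ⟦X⟧) = (2 * (j : ℚ⟦X⟧) + 1) * X * (1 + X) * (q : ℚ⟦X⟧) +
          (1 - X) * ((k : ℚ⟦X⟧) * (1 + X) * (q : ℚ⟦X⟧) + X * (q : ℚ⟦X⟧) +
            X * (1 + X) * ((Polynomial.derivative q : ℚ[X]) : ℚ⟦X⟧)) -
          (j : ℚ⟦X⟧) * (1 - X) ^ 2 * (q : ℚ⟦X⟧) := by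
      have hc : ∀ m : ℕ, ((m : ℚ[X]) : ℚ⟦X⟧) = (m : ℚ⟦X⟧) := fun m =>
        map_natCast (Polynomial.coeToPowerSeries.ringHom (R := ℚ)) m
      have h2 : ((2 : ℚ[X]) : ℚ⟦X⟧) = 2 :=
        map_ofNat (Polynomial.coeToPowerSeries.ringHom (R := ℚ)) 2
      simp only [p, Polynomial.coe_sub, Polynomial.coe_add, Polynomial.coe_mul, Polynomial.coe_pow,
        Polynomial.coe_one, Polynomial.coe_X, hc, h2]
    refine ⟨Polynomial.C ((j : ℚ) + 1)⁻¹ * p, ?_, ?_⟩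
    · have d1 : (1 - Polynomial.X : ℚ[X]).natDegree ≤ 1 := by compute_degree
      have d2 : (1 + Polynomial.X : ℚ[X]).natDegree ≤ 1 := by compute_degree
      have d3 := Polynomial.natDegree_derivative_le q
      have d4 : (2 * (j : ℚ[X]) + 1).natDegree ≤ 0 := by compute_degree
      have d5 : (j : ℚ[X]).natDegree ≤ 0 := by simp
      have d6 : (k : ℚ[X]).natDegree ≤ 0 := by simp
      have d7 : (Polynomial.X : ℚ[X]).natDegree ≤ 1 := Polynomial.natDegree_X_le
      have m : ∀ {f g : ℚ[X]} {a b : ℕ}, f.natDegree ≤ a → g.natDegree ≤ b →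
          (f * g).natDegree ≤ a + b := fun h h' => Polynomial.natDegree_mul_le_of_le h h'
      refine (Polynomial.natDegree_C_mul_le _ _).trans ?_
      refine Polynomial.natDegree_sub_le_of_le (Polynomial.natDegree_add_le_of_degree_le ?_ ?_) ?_
        |>.trans (max_self (2 * (j + 1))).le
      · exact (m (m (m d4 d7) d2) hq).trans (by omega)
      · refine (m (b := 2 * j + 1) d1 (Polynomial.natDegree_add_le_of_degree_le
          (Polynomial.natDegree_add_le_of_degree_le ?_ ?_) ?_)).trans (by omega)
        · exact (m (m d6 d2) hq).trans (by omega)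
        · exact (m d7 hq).trans (by omega)
        · rcases Nat.eq_zero_or_pos q.natDegree with h0 | h0
          · rw [Polynomial.derivative_of_natDegree_zero h0, mul_zero, Polynomial.natDegree_zero]
            omega
          · exact (m (m d7 d2) d3).trans (by omega)
      · exact (m (m d5 (Polynomial.natDegree_pow_le_of_le 2 d1)) hq).trans (by omega)
    · have hj : C ((j : ℚ) + 1)⁻¹ * C ((j : ℚ) + 1) = (1 : ℚ⟦X⟧) := by
        rw [← map_mul, inv_mul_cancel₀ (by positivity), map_one]
      have hmain : (T - C (j : ℚ) * F) * (1 - X) ^ (2 * (j + 1) + 1) =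
          X ^ k * (1 + X) * (p : ℚ⟦X⟧) := by
        rw [hp, show C (j : ℚ) = (j : ℚ⟦X⟧) by simp,
          show 2 * (j + 1) + 1 = 2 * j + 1 + 2 by ring, pow_add]
        linear_combination (1 - X) ^ (2 * j + 1) * (1 - X) * hθ + (1 + X) * hder -
          (j : ℚ⟦X⟧) * (1 - X) ^ 2 * h
      rw [Polynomial.coe_mul, Polynomial.coe_C]
      rw [← hrec] at hmain
      linear_combination C ((j : ℚ) + 1)⁻¹ * hmain -
        (weightedCentralSeries (j + 1) k).subst changeVar * (1 - X) ^ (2 * (j + 1) + 1) * hj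

end ChangeOfVariable

open PowerSeries NCPartition in
theorem gTilde_zero (a b : ℕ) : gTilde 0 a b = if a = 0 ∧ b = 0 then PowerSeries.X else 0 := by
  have hs := changeVar_hasSubst
  split_ifs with hab
  · obtain ⟨rfl, rfl⟩ := hab
    set G := gTilde 0 0 0 with hG
    -- the Catalan series minus its constant term satisfies `g = X * (1 + g) ^ 2`
    have hfun : gCoeff 0 0 0 = X * (1 + gCoeff 0 0 0) ^ 2 := by
      have hc : 1 + gCoeff 0 0 0 = map (Nat.castRingHom ℚ) catalanSeries := by
        ext n
        rw [map_add, coeff_one, gCoeff, PowerSeries.coeff_mk, coeff_map, catalanSeries_coeff]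
        split_ifs with hn
        · subst hn; simp
        · rw [ncard_meandricPairs_zero]; simp
      have h := congrArg (map (Nat.castRingHom ℚ)) catalanSeries_sq_mul_X_add_one
      rw [map_add, map_mul, map_pow, map_one, map_X, ← hc] at h
      linear_combination -h
    have hsub : G = changeVar * (1 + G) ^ 2 := by
      have h := congrArg (fun f : ℚ⟦X⟧ => f.subst changeVar) hfun
      simp only [subst_mul hs, subst_pow hs, subst_add hs, subst_X hs, subst_one_changeVar] at h
      exact h
    have hconst : constantCoeff G = 0 := by
      rw [hsub]; simp [changeVar]
    -- `W` and `g` are two roots of a quadratic equation, the other factor being a unit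
    have hprod : (G - X) * (1 - X * G) = 0 := by
      linear_combination (1 + X) ^ 2 * hsub + (1 + G) ^ 2 * changeVar_mul_one_add_X_sq
    have hu : IsUnit (1 - X * G : ℚ⟦X⟧) := by
      rw [isUnit_iff_constantCoeff]; simp
    exact sub_eq_zero.1 (hu.mul_left_eq_zero.1 hprod)
  · have h0 : gCoeff 0 a b = 0 := by
      ext n
      rw [gCoeff, PowerSeries.coeff_mk, ncard_meandricPairs_zero, if_neg hab]
      simp
    rw [gTilde, h0, ← coe_substAlgHom hs, map_zero]

open PowerSeries NCPartition in
theorem exists_polynomial_gTilde {r : ℕ} (hr : 1 ≤ r) (a b : ℕ) : ∃ P : ℚ[X],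
    P.natDegree ≤ 3 * r - 3 ∧ gTilde r a b * (1 - X) ^ (2 * r - 1) =
      X ^ (r + 1) * (1 + X) * (P : ℚ⟦X⟧) := by
  have hs := changeVar_hasSubst
  choose q hq hqs using exists_polynomial_subst_weightedCentralSeries
  obtain ⟨c, hc⟩ : ∃ c : ℕ → ℕ → ℚ, ∀ k j, c k j =
    (coeff k (reducedSeries ^ (j + 1))).coeff (r, a, b) / (j + 1) := ⟨_, fun _ _ => rfl⟩
  have hg : gCoeff r a b = ∑ k ∈ Finset.Icc (r + 1) (2 * r), ∑ j ∈ Finset.range r,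
      c k j • weightedCentralSeries j k := by
    ext n
    simp only [gCoeff, weightedCentralSeries, map_sum, coeff_smul, PowerSeries.coeff_mk, hc,
      smul_eq_mul]
    split_ifs with hn
    · subst hn
      refine (Finset.sum_eq_zero fun k hk => Finset.sum_eq_zero fun j _ => ?_).symm
      rw [Nat.choose_eq_zero_of_lt (by rw [Finset.mem_Icc] at hk; omega : 2 * 0 < 0 + k)]
      simp
    · exact ncard_meandricPairs_eq_sum hr n a b
  refine ⟨∑ k ∈ Finset.Icc (r + 1) (2 * r), ∑ j ∈ Finset.range r,
    Polynomial.C (c k j) * Polynomial.X ^ (k - (r + 1)) * q j k *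
      (1 - Polynomial.X) ^ (2 * (r - 1 - j)), ?_, ?_⟩
  · refine Polynomial.natDegree_sum_le_of_forall_le _ _ fun k hk =>
      Polynomial.natDegree_sum_le_of_forall_le _ _ fun j hj => ?_
    rw [Finset.mem_Icc] at hk
    rw [Finset.mem_range] at hj
    have d1 : (1 - Polynomial.X : ℚ[X]).natDegree ≤ 1 := by compute_degree
    have d2 := Polynomial.natDegree_pow_le_of_le (2 * (r - 1 - j)) d1
    have d3 := Polynomial.natDegree_C_mul_X_pow_le (c k j) (k - (r + 1))
    exact (Polynomial.natDegree_mul_le_of_le (Polynomial.natDegree_mul_le_of_le d3 (hq j k))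
      d2).trans (by omega)
  · have hcoe : ∀ f : ℚ[X], (f : ℚ⟦X⟧) = Polynomial.coeToPowerSeries.ringHom f := fun _ => rfl
    rw [gTilde, hg, ← coe_substAlgHom hs, hcoe]
    simp only [map_sum, map_smul]
    rw [Finset.sum_mul, Finset.mul_sum]
    refine Finset.sum_congr rfl fun k hk => ?_
    rw [Finset.sum_mul, Finset.mul_sum]
    refine Finset.sum_congr rfl fun j hj => ?_
    rw [Finset.mem_Icc] at hk
    rw [Finset.mem_range] at hj
    rw [← hcoe, coe_substAlgHom hs]
    simp only [Polynomial.coe_sub, Polynomial.coe_mul, Polynomial.coe_pow,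
        Polynomial.coe_one, Polynomial.coe_X, Polynomial.coe_C]
    rw [smul_eq_C_mul, show 2 * r - 1 = 2 * j + 1 + 2 * (r - 1 - j) by omega, pow_add]
    have hX : (X : ℚ⟦X⟧) ^ (r + 1) * X ^ (k - (r + 1)) = X ^ k := by
      rw [← pow_add, Nat.add_sub_cancel' hk.1]
    linear_combination C (c k j) * (1 - X) ^ (2 * (r - 1 - j)) * hqs j k -
      (1 + X) * C (c k j) * (q j k : ℚ⟦X⟧) * (1 - X) ^ (2 * (r - 1 - j)) * hX

theorem proposition5p4 :
    gTilde 0 0 0 = PowerSeries.X ∧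
    (∀ a b : ℕ, (a, b) ≠ (0, 0) → gTilde 0 a b = 0) ∧
    (∀ r a b : ℕ, 1 ≤ r → Compatible r a b →
      ∃ P : ℚ[X], P.natDegree ≤ 3 * r - 3 ∧
        gTilde r a b =
          PowerSeries.X ^ (r + 1) * (1 + PowerSeries.X) * (P : ℚ⟦X⟧) *
            ((1 - PowerSeries.X) ^ (2 * r - 1))⁻¹) := by
  refine ⟨by rw [gTilde_zero, if_pos ⟨rfl, rfl⟩], fun a b hab => ?_, fun r a b hr _ => ?_⟩
  · rw [gTilde_zero, if_neg]
    rintro ⟨rfl, rfl⟩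
    exact hab rfl
  · obtain ⟨P, hP, h⟩ := exists_polynomial_gTilde hr a b
    exact ⟨P, hP, (PowerSeries.eq_mul_inv_iff_mul_eq (by simp)).2 h⟩
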